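/- **CTMDPs.** A continuous-time Markov decision process (CTMDP) $\mathcal M$ consists of finite sets $L$ of locations and $A$ of actions, a goal region $G\subseteq L$, rates $R(l,a,l')\ge 0$ and an initial distribution $\nu$ on $L$. Put $R(l,a,L)=\sum_{l'}R(l,a,l')$; the action $a$ is enabled in $l$, written $a\in A(l)$, if $R(l,a,L)>0$. Every $A(l)$ is nonempty, and $G$ is absorbing: $R(l,a,l')=0$ for $l\in G$, $l'\notin G$. Fix a time bound $T\ge 0$. **Schedulers.** A timed path is a sequence $\pi=l_0\xrightarrow{a_0,t_0}l_1\cdots\xrightarrow{a_{n-1},t_{n-1}}l_n$ with ordered transition times $t_i\le T$. A timed history-dependent randomised (THR) scheduler $\sigma$ maps a timed path $\pi$ ending in $l$ and the current time $t$ to a distribution $\sigma(\pi,t)$ on $A(l)$. A timed-positional deterministic (TPD) scheduler $S$ maps a location $l$ and the current time $t$ to an action $S(l,t)\in A(l)$; it is regarded as a THR scheduler. On a history $\pi$ ending in $l$, a transition to $l'$ under action $a$ occurs at time $t$ with rate $\sigma(\pi,t)(a)\,R(l,a,l')$. $\Pr_\sigma(l,t)$ denotes the resulting probability that the path up to time $T$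 visits $G$ when starting in $l$ at time $t$ (with empty history), and $\Pr_\sigma=\sum_l\nu(l)\Pr_\sigma(l,0)$. **Measurable schedulers.** A scheduler is cylindrical if, for some finite partition of $[0,T]$ into intervals $[0,s_0],(s_0,s_1],\dots,(s_{k-1},s_k]$, its decisions depend on the transition times in the history and on the current time only through the intervals that contain them. The distance of two schedulers $D,E$ is the probability of reaching, within time $T$ from $\nu$, a fresh absorbing goal location $g$ in an adjusted CTMDP: on a history on which $D$ and $E$ choose actions with probabilities $p_a$ and $q_a$, the old action $a$ is chosen with probability $\min(p_a,q_a)$, and the remaining probability is given to a fresh action $(a_D,a_E)$ that leads to $g$ with rate $R(l,a_D,L)+R(l,a_E,L)$, where $a_D$ (respectively $a_E$) has maximal rate $R(l,\cdot,L)$ among the actions with $p_a>q_a$ (respectively $q_a>p_a$). A scheduler is measurable if it is a Borel function of the transition times in the history and of the current time, and is, with respect to this distance, the limit of a Cauchy sequence of cylindrical schedulers. **Theorem.** For every CTMDP and every $T\ge0$ there is a measurable TPD scheduler $S$ that is optimal for maximum time-bounded reachability in the class of measurable THR schedulers: $\Pr_\sigma\le\Pr_S$, and moreover $\Pr_\sigma(l,t)\le\Pr_S(l,t)$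 for all $l\in L$ and $t\in[0,T]$, for every measurable THR scheduler $\sigma$. Furthermore, $S$ can be chosen such that 1. on $[0,T]$, $\Pr_S(l,t)$ equals $f_{\max}(l,t)$, the unique solution of $$-\dot f(l,t)=\max_{a\in A(l)}\sum_{l'\in L}R(l,a,l')\,\bigl(f(l',t)-f(l,t)\bigr)\qquad(l\in L,\ t\in[0,T])$$ (with one-sided derivatives at the end points) with $f(l,t)=1$ for $l\in G$, $t\in[0,T]$, and $f(l,T)=0$ for $l\notin G$; 2. for all $l\in L$ and $t\in[0,T]$, the action $a=S(l,t)$ maximises the gain $\sum_{l'}R(l,a,l')\bigl(f_{\max}(l',t)-f_{\max}(l,t)\bigr)$ over $A(l)$; 3. for all $l$ and $a$, the set $\{t\in[0,T]: S(l,t)=a\}$ has the form $\overline{U}\cap O$ for sets $U\subseteq O\subseteq[0,T]$ that are open in $[0,T]$. -/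

import Mathlib

open MeasureTheory Set Filter Topology
open scoped NNReal ENNReal

/-- A continuous-time Markov decision process with finitely many locations `L` and actions `A`
(all locations are continuous and belong to the maximising player). The transition probabilities
are determined by the rates: `P(l,a,l') = R(l,a,l') / R(l,a,L)` for enabled actions. -/
structure CTMDP (L A : Type*) [Fintype L] [Fintype A] where
  /-- the goal region -/
  goal : Set L
  /-- the rate matrix `R(l,a,l')` -/
  rate : L → A → L → ℝ≥0
  /-- the initial distribution -/
  init : L → ℝ≥0
  init_sum : ∑ l, init l = 1
  /-- every location has an enabled action -/
  exists_enabled : ∀ l, ∃ a, 0 < ∑ l', rate l a l'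
  /-- the goal region is absorbing -/
  goal_absorbing : ∀ l ∈ goal, ∀ a, ∀ l' ∉ goal, rate l a l' = 0

/-- The time-abstract part `l₀ -a₀→ l₁ -a₁→ ⋯ → lₙ` of a timed path. -/
structure Skeleton (L A : Type*) where
  /-- number of transitions -/
  len : ℕ
  /-- the locations `l₀, …, lₙ` -/
  loc : Fin (len + 1) → L
  /-- the actions `a₀, …, aₙ₋₁` -/
  act : Fin len → A

/-- Timed paths `l₀ -(a₀,t₀)→ l₁ -(a₁,t₁)→ ⋯ → lₙ`: a skeleton and the points in (absolute
system) time of its transitions. The σ-algebra is the Borel one for every fixed skeleton. -/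
abbrev TimedPath (L A : Type*) := (s : Skeleton L A) × (Fin s.len → ℝ)

namespace TimedPath

variable {L A : Type*}

/-- The last location of a path. -/
def last (π : TimedPath L A) : L := π.1.loc (Fin.last π.1.len)

/-- The prefix of a path that consists of its first `k` transitions. -/
def take (π : TimedPath L A) (k : Fin (π.1.len + 1)) : TimedPath L A :=
  ⟨⟨k, fun j => π.1.loc (j.castLE (by omega)), fun j => π.1.act (j.castLE (by omega))⟩,
    fun j => π.2 (j.castLE (Nat.le_of_lt_succ k.isLt))⟩

/-- The points in time at which the locations of the path are entered, for a path that
starts at time `t₀`. -/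
def entry (t₀ : ℝ) (π : TimedPath L A) : Fin (π.1.len + 1) → ℝ := Fin.cons t₀ π.2

/-- The transition times are ordered, and lie between the starting time and the time bound. -/
def Valid (T t₀ : ℝ) (π : TimedPath L A) : Prop :=
  Monotone (π.entry t₀) ∧ ∀ i, π.entry t₀ i ≤ T

end TimedPath

noncomputable section

namespace CTMDP

variable {L A : Type*} [Fintype L] [Fintype A]

/-- `R(l,a,L)` -/
def exit (M : CTMDP L A) (l : L) (a : A) : ℝ≥0 := ∑ l', M.rate l a l'

/-- `a` is enabled in `l`, that is, `a ∈ act(l)`. -/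
def Enabled (M : CTMDP L A) (l : L) (a : A) : Prop := 0 < M.exit l a

/-- Timed history-dependent randomised (THR) schedulers: they map a timed path and the current
point in time to a distribution over the actions enabled in the last location of the path. (For a
fixed time bound, knowing the current time is the same as knowing the remaining time.) Only the
values on valid paths, and for times between the last transition and the time bound, matter. -/
structure THRScheduler (M : CTMDP L A) where
  /-- the likelihood of choosing an action -/
  prob : TimedPath L A → ℝ → A → ℝ≥0
  sum_prob : ∀ π t, ∑ a, prob π t a = 1
  enabled : ∀ π t a, prob π t a ≠ 0 → M.Enabled π.last a

/-- Timed positional deterministic (TPD) schedulers. -/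
structure TPDScheduler (M : CTMDP L A) where
  /-- the chosen action -/
  choice : L → ℝ → A
  enabled : ∀ l t, M.Enabled l (choice l t)

open scoped Classical in
/-- A TPD scheduler as a THR scheduler. -/
def TPDScheduler.toTHR {M : CTMDP L A} (S : M.TPDScheduler) : M.THRScheduler where
  prob π t a := if a = S.choice π.last t then 1 else 0
  sum_prob π t := by simp
  enabled π t a h := by
    have h' : a = S.choice π.last t := by
      by_contra hne
      simp [hne] at h
    exact h' ▸ S.enabled _ _

section Law

variable (M : CTMDP L A) (T : ℝ) (σ : M.THRScheduler)

/-- The expected transition rate at time `u` on the history `π`. -/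
def exitRate (π : TimedPath L A) (u : ℝ) : ℝ := ∑ a, (σ.prob π u a : ℝ) * M.exit π.last a

/-- The probability of making no transition between times `s` and `t` on the history `π`. -/
def survival (π : TimedPath L A) (s t : ℝ) : ℝ := Real.exp (-∫ u in s..t, M.exitRate σ π u)

open scoped Classical in
/-- The density at a path of being the complete timed path up to the time bound `T`, when starting
at time `t₀` in the first location of the path: on a history that ends in `l`, transitions to `l'`
under action `a` occur at time `u` with rate `σ(π,u)(a) · R(l,a,l')`. -/
def pathDensity (t₀ : ℝ) (π : TimedPath L A) : ℝ :=
  if π.Valid T t₀ then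
    (∏ i : Fin π.1.len,
      M.survival σ (π.take i.castSucc) (π.entry t₀ i.castSucc) (π.entry t₀ i.succ) *
        (σ.prob (π.take i.castSucc) (π.entry t₀ i.succ) (π.1.act i) *
          M.rate (π.1.loc i.castSucc) (π.1.act i) (π.1.loc i.succ))) *
      M.survival σ π (π.entry t₀ (Fin.last _)) T
  else 0

open scoped Classical in
/-- The law of the complete timed path up to the time bound `T`, when starting in location `l` at
time `t₀`. -/
def pathLaw (l : L) (t₀ : ℝ) : Measure (TimedPath L A) :=
  Measure.sum fun s : Skeleton L A =>
    if s.loc 0 = l then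
      (volume.withDensity fun τ : Fin s.len → ℝ =>
        ENNReal.ofReal (M.pathDensity T σ t₀ ⟨s, τ⟩)).map (Sigma.mk s)
    else 0

/-- `Pr_σ(l,t)`: the probability of visiting the goal region up to the time bound `T`, when
starting in location `l` at time `t`. -/
def reach (l : L) (t : ℝ) : ℝ :=
  (M.pathLaw T σ l t).real {π | ∃ i, π.1.loc i ∈ M.goal}

/-- The time-bounded reachability probability for the initial distribution. -/
def reachProb : ℝ := ∑ l, (M.init l : ℝ) * M.reach T σ l 0

end Law

/-! ### Cylindrical schedulers

A finite partition of `[0,T]` into `[0,t₀], (t₀,t₁], …, (tₙ₋₁,tₙ]` with `0 ≤ t₀ < ⋯ < tₙ = T` is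
represented by the set of its right endpoints. -/

/-- The finite set of right endpoints of a partition of `[0,T]`. -/
def IsPartition (T : ℝ) (J : Finset ℝ) : Prop := T ∈ J ∧ ∀ b ∈ J, 0 ≤ b ∧ b ≤ T

/-- `t` and `t'` lie in the same interval of the partition. -/
def SameCell (J : Finset ℝ) (t t' : ℝ) : Prop := ∀ b ∈ J, t ≤ b ↔ t' ≤ b

/-- Decisions depend only on the intervals that contain the times in the history and the current
time, for some finite partition. -/
def THRScheduler.IsCylindrical {M : CTMDP L A} (σ : M.THRScheduler) (T : ℝ) : Prop :=
  ∃ J : Finset ℝ, IsPartition T J ∧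
    ∀ (s : Skeleton L A) (τ τ' : Fin s.len → ℝ) (t t' : ℝ),
      (∀ i, SameCell J (τ i) (τ' i)) → SameCell J t t' → σ.prob ⟨s, τ⟩ t = σ.prob ⟨s, τ'⟩ t'

/-! ### The difference of two schedulers

The difference of `D` and `E` is the probability that they are seen to act differently: the
probability of reaching a fresh goal location `none` in an adjusted CTMDP, where a fresh action
`(a,b)` leads to `none` with rate `R(l,a,L) + R(l,b,L)`. It is chosen with the likelihood
with which the decisions of `D` and `E` disagree. -/

/-- The old actions, the fresh actions `(a,b)`, and the only action enabled in `none`. -/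
abbrev DiffAct (A : Type*) := A ⊕ (A × A) ⊕ Unit

/-- The rates of the adjusted CTMDP. -/
def diffRate (M : CTMDP L A) : Option L → DiffAct A → Option L → ℝ≥0
  | some l, Sum.inl a, some l' => M.rate l a l'
  | some l, Sum.inr (Sum.inl (a, b)), none => M.exit l a + M.exit l b
  | none, Sum.inr (Sum.inr ()), none => 1
  | _, _, _ => 0

/-- The adjusted CTMDP. -/
def diffModel (M : CTMDP L A) : CTMDP (Option L) (DiffAct A) where
  goal := {none}
  rate := M.diffRate
  init o := o.elim 0 M.init
  init_sum := by simpa [Fintype.sum_option] using M.init_sum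
  exists_enabled l := by
    cases l with
    | none => exact ⟨Sum.inr (Sum.inr ()), by simp [Fintype.sum_option, diffRate]⟩
    | some l =>
      obtain ⟨a, ha⟩ := M.exists_enabled l
      exact ⟨Sum.inl a, by simpa [Fintype.sum_option, diffRate] using ha⟩
  goal_absorbing l hl a l' hl' := by
    obtain rfl : l = none := hl
    cases l' with
    | none => exact absurd rfl hl'
    | some l' => rcases a with a | a | a <;> simp [diffRate]

/-- Some enabled action. -/
def someEnabled (M : CTMDP L A) (l : L) : A := (M.exists_enabled l).choose

/-- Reads a path of the adjusted CTMDP as a path of the original one, where `l` and `a` replace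
the fresh locations and actions (that do not occur on paths with positive likelihood that end in an
old location). -/
def projPath (l : L) (a : A) (π : TimedPath (Option L) (DiffAct A)) : TimedPath L A :=
  ⟨⟨π.1.len, fun i => (π.1.loc i).getD l, fun i => (π.1.act i).elim id fun _ => a⟩, π.2⟩

open scoped Classical in
/-- An action with the highest transition rate among those that are more likely under `p` than
under `q` (if there is one). -/
def topAct (M : CTMDP L A) (l : L) (p q : A → ℝ≥0) : A :=
  if h : (Finset.univ.filter fun a => q a < p a).Nonempty then
    (Finset.exists_max_image _ (M.exit l) h).choose
  else M.someEnabled l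

theorem topAct_spec (M : CTMDP L A) (l : L) (p q : A → ℝ≥0) (hp : ∑ a, p a = 1)
    (h : ∑ a, min (p a) (q a) ≠ 1) : q (M.topAct l p q) < p (M.topAct l p q) := by
  classical
  have hne : (Finset.univ.filter fun a => q a < p a).Nonempty := by
    by_contra hc
    rw [Finset.not_nonempty_iff_eq_empty, Finset.filter_eq_empty_iff] at hc
    refine h ?_
    rw [← hp]
    exact Finset.sum_congr rfl fun a _ => min_eq_left (not_lt.mp (hc (Finset.mem_univ a)))
  have hs := (Finset.exists_max_image _ (M.exit l) hne).choose_spec.1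
  rw [topAct, dif_pos hne]
  exact (Finset.mem_filter.mp hs).2

open scoped Classical in
/-- The decision of the difference scheduler in an old location `l`, where the two schedulers take
the decisions `p` and `q`. -/
def diffDecision (M : CTMDP L A) (l : L) (p q : A → ℝ≥0) : DiffAct A → ℝ≥0
  | Sum.inl a => min (p a) (q a)
  | Sum.inr (Sum.inl (a, b)) =>
      if (a, b) = (M.topAct l p q, M.topAct l q p) then 1 - ∑ c, min (p c) (q c) else 0
  | Sum.inr (Sum.inr ()) => 0

open scoped Classical in
/-- The decision of the difference scheduler of `D` and `E`. -/
def diffProb {M : CTMDP L A} (D E : M.THRScheduler) (π : TimedPath (Option L) (DiffAct A))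
    (t : ℝ) : DiffAct A → ℝ≥0 :=
  π.last.elim (fun a => if a = Sum.inr (Sum.inr ()) then 1 else 0) fun l =>
    M.diffDecision l (D.prob (projPath l (M.someEnabled l) π) t)
      (E.prob (projPath l (M.someEnabled l) π) t)

theorem sum_diffDecision (M : CTMDP L A) (l : L) (p q : A → ℝ≥0) (hp : ∑ a, p a = 1) :
    ∑ x, M.diffDecision l p q x = 1 := by
  classical
  have hle : ∑ c, min (p c) (q c) ≤ 1 :=
    hp ▸ Finset.sum_le_sum fun a _ => min_le_left _ _
  have h2 : ∑ x : A × A, M.diffDecision l p q (Sum.inr (Sum.inl x)) =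
      1 - ∑ c, min (p c) (q c) := by
    rw [Finset.sum_eq_single (M.topAct l p q, M.topAct l q p)]
    · simp [diffDecision]
    · rintro ⟨a, b⟩ - hne
      simp only [diffDecision]
      rw [if_neg hne]
    · simp
  rw [Fintype.sum_sum_type, Fintype.sum_sum_type, h2]
  simp [diffDecision, add_tsub_cancel_of_le hle]

theorem enabled_diffDecision (M : CTMDP L A) (l : L) (p q : A → ℝ≥0) (hp : ∑ a, p a = 1)
    (h : ∀ a, p a ≠ 0 → M.Enabled l a) (x : DiffAct A) (hx : M.diffDecision l p q x ≠ 0) :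
    M.diffModel.Enabled (some l) x := by
  classical
  rcases x with a | ⟨a, b⟩ | u
  · have ha : p a ≠ 0 := by
      intro h0
      simp [diffDecision, h0] at hx
    have := h a ha
    simpa [Enabled, exit, diffModel, diffRate, Fintype.sum_option] using this
  · simp only [diffDecision] at hx
    split_ifs at hx with hab
    · have hne : ∑ c, min (p c) (q c) ≠ 1 := by
        intro h1
        simp [h1] at hx
      have hlt := M.topAct_spec l p q hp hne
      have he := h _ (ne_of_gt (lt_of_le_of_lt (zero_le (a := q (M.topAct l p q))) hlt))
      have ha : a = M.topAct l p q := (Prod.mk.inj hab).1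
      have he' : 0 < M.exit l a := ha ▸ he
      have : 0 < M.exit l a + M.exit l b := by positivity
      simpa [Enabled, exit, diffModel, diffRate, Fintype.sum_option] using this
    · exact absurd rfl hx
  · exact absurd rfl hx

/-- The difference scheduler of `D` and `E` for the adjusted CTMDP. -/
def diffScheduler {M : CTMDP L A} (D E : M.THRScheduler) : M.diffModel.THRScheduler where
  prob := diffProb D E
  sum_prob π t := by
    classical
    unfold diffProb
    rcases heq : π.last with _ | l
    · simp
    · exact M.sum_diffDecision _ _ _ (D.sum_prob _ _)
  enabled π t a h := by
    classical
    unfold diffProb at h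
    rcases heq : π.last with _ | l
    · rw [heq] at h
      have ha : a = Sum.inr (Sum.inr ()) := by
        by_contra hne
        simp [hne] at h
      rw [ha]
      simp [Enabled, exit, diffModel, diffRate, Fintype.sum_option]
    · rw [heq] at h
      refine M.enabled_diffDecision l _ _ (D.sum_prob _ _) ?_ a h
      intro b hb
      have := D.enabled _ _ _ hb
      have hl : (projPath l (M.someEnabled l) π).last = l := by
        have h1 : π.1.loc (Fin.last π.1.len) = some l := heq
        simp [TimedPath.last, projPath, h1]
      rwa [hl] at this

/-- The difference (pseudo)metric on schedulers. -/
def schedDist {M : CTMDP L A} (T : ℝ) (D E : M.THRScheduler) : ℝ :=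
  M.diffModel.reachProb T (diffScheduler D E)

/-- A scheduler is measurable if it is a Borel function of the transition times of the history and
the current time, and the limit of a Cauchy sequence of cylindrical schedulers. -/
structure THRScheduler.IsMeasurable {M : CTMDP L A} (σ : M.THRScheduler) (T : ℝ) : Prop where
  borel : ∀ (s : Skeleton L A) (a : A),
    Measurable fun p : (Fin s.len → ℝ) × ℝ => σ.prob ⟨s, p.1⟩ p.2 a
  limit : ∃ c : ℕ → M.THRScheduler, (∀ n, (c n).IsCylindrical T) ∧
    (∀ ε > 0, ∃ N, ∀ m ≥ N, ∀ n ≥ N, schedDist T (c m) (c n) < ε) ∧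
    Tendsto (fun n => schedDist T (c n) σ) atTop (𝓝 0)

/-! ### The Bellman equations -/

/-- The gain of action `a` in location `l` at time `t`, with respect to `f`. -/
def gain (M : CTMDP L A) (f : L → ℝ → ℝ) (l : L) (a : A) (t : ℝ) : ℝ :=
  ∑ l', (M.rate l a l' : ℝ) * (f l' t - f l t)

/-- `f` solves the Bellman equations
`-f'(l,t) = max {∑ l', R(l,a,l') * (f(l',t) - f(l,t)) | a ∈ act(l)}` on `[0,T]`, where `f` is `1` on
the goal region, and `0` elsewhere at time `T`. (The supremum is over a finite nonempty set.) -/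
structure IsBellmanMax (M : CTMDP L A) (T : ℝ) (f : L → ℝ → ℝ) : Prop where
  goal : ∀ l ∈ M.goal, ∀ t ∈ Icc 0 T, f l t = 1
  final : ∀ l ∉ M.goal, f l T = 0
  deriv : ∀ l, ∀ t ∈ Icc 0 T,
    HasDerivWithinAt (f l) (-⨆ a : {a // M.Enabled l a}, M.gain f l a t) (Icc 0 T) t

end CTMDP

end

/-!
The proof is a verification argument for the Bellman equations.

*Existence and uniqueness.* The Bellman operator is Lipschitz. Its clamped version is moreover
bounded, so Picard-Lindelöf gives a solution on all of `[0,T]`, and a fencing argument shows that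
this solution never leaves `[0,1]` and hence solves the original equations
(`CTMDP.exists_isBellmanMax`). Uniqueness is Gronwall's inequality (`CTMDP.IsBellmanMax.eqOn`).

*Verification.* For a potential `φ(l,t)`, consider the expectation of `φ` at the location and time
reached by the `n`-th transition, restricted to transitions before `T` (`CTMDP.stepSum`). If the
expected gain `∑ a, σ(π,t)(a) * gain φ l a t` on every history is at most the rate of decrease
`-φ'` and `φ(·,T)` is at least the indicator of the goal region, then integration by parts against
the survival function shows that a step loses at least the probability of ending in the goal region
after exactly `n` transitions. Summing up, the reachability probability is at most `φ`
(`CTMDP.reach_le`). If both comparisons are equalities, then so is the conclusion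
(`CTMDP.reach_eq`), because the remainder vanishes: the expectation of an exponentially weighted
potential at least halves with every transition. With the Bellman solution as `φ` this proves that
every Borel scheduler is dominated by `φ`, with equality for a scheduler that always maximises the
gain.

*Selection.* For fixed `l`, the closed sets of times at which an action is optimal cover `[0,T]`.
By Baire's theorem so do the closures of their interiors. Choosing the first action, in a fixed
enumeration, for which this closure contains the current time gives decision sets of the required
form `closure U ∩ O` (`CTMDP.image_selectionTimes`).

*Measurability.* These sets are Borel, and Borel sets are approximated in measure by finite unions
of intervals, so a Borel positional scheduler is approximated by cylindrical ones up to a small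
amount of time. The distance of two positional schedulers is at most `2 * rateBound` times the
amount of time at which they differ (`CTMDP.schedDist_le`), which is `CTMDP.reach_le` once more,
applied in the adjusted CTMDP.
-/

/-! ### Integration by parts against a survival function -/

/-- Integration by parts for a survival function with hazard rate `E` and a function
`f u = c + ∫ v in u..T, q v`; both are only absolutely continuous, as `E` and `q` need not be
continuous. -/
theorem integral_survival_mul {E q : ℝ → ℝ} {s T c C : ℝ} {f : ℝ → ℝ} (hsT : s ≤ T)
    (hEm : Measurable E) (hE0 : ∀ u ∈ Icc s T, 0 ≤ E u) (hEC : ∀ u ∈ Icc s T, E u ≤ C)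
    (hq : IntervalIntegrable q volume s T)
    (hf : ∀ u ∈ Icc s T, f u = c + ∫ v in u..T, q v) :
    ∫ u in s..T, Real.exp (-∫ v in s..u, E v) * (q u + E u * f u) =
      f s - Real.exp (-∫ v in s..T, E v) * f T := by
  have hu : uIcc s T = Icc s T := uIcc_of_le hsT
  have hEI : IntervalIntegrable E volume s T := by
    rw [intervalIntegrable_iff, uIoc_of_le hsT]
    refine Measure.integrableOn_of_bounded (M := C) (by simp) hEm.aestronglyMeasurable ?_
    filter_upwards [ae_restrict_mem measurableSet_Ioc] with u hu
    rw [Real.norm_eq_abs, abs_of_nonneg (hE0 u ⟨hu.1.le, hu.2⟩)]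
    exact hEC u ⟨hu.1.le, hu.2⟩
  set g : ℝ → ℝ := fun u => Real.exp (-∫ v in s..u, E v) with hg
  set h : ℝ → ℝ := fun u => c + ∫ v in u..T, q v with hh
  have hG0 : ∀ u ∈ Icc s T, 0 ≤ ∫ v in s..u, E v := fun u hu =>
    intervalIntegral.integral_nonneg hu.1 fun v hv => hE0 v ⟨hv.1, hv.2.trans hu.2⟩
  have hC : 0 ≤ C := (hE0 s ⟨le_rfl, hsT⟩).trans (hEC s ⟨le_rfl, hsT⟩)
  -- `g` is the composition of `exp`, which is 1-Lipschitz on `(-∞, 0]`, with a Lipschitz function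
  have hgac : AbsolutelyContinuousOnInterval g s T := by
    have h1 : LipschitzOnWith (Real.toNNReal C) (fun u => -∫ v in s..u, E v) (Icc s T) := by
      refine LipschitzOnWith.of_dist_le_mul fun x hx y hy => ?_
      have hsub : ∀ z ∈ Icc s T, IntervalIntegrable E volume s z := fun z hz =>
        hEI.mono_set (by rw [hu, uIcc_of_le hz.1]; exact Icc_subset_Icc le_rfl hz.2)
      rw [dist_neg_neg, Real.dist_eq, intervalIntegral.integral_interval_sub_left (hsub x hx)
        (hsub y hy), Real.coe_toNNReal _ hC, Real.dist_eq]
      refine intervalIntegral.norm_integral_le_of_norm_le_const (f := E) fun v hv => ?_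
      have hv' : v ∈ Icc s T := by
        rw [uIoc, mem_Ioc] at hv
        exact ⟨(le_min hy.1 hx.1).trans hv.1.le, hv.2.trans (max_le hy.2 hx.2)⟩
      rw [Real.norm_eq_abs, abs_of_nonneg (hE0 v hv')]
      exact hEC v hv'
    have h2 : LipschitzOnWith 1 Real.exp (Iic 0) := by
      refine (convex_Iic (0 : ℝ)).lipschitzOnWith_of_nnnorm_deriv_le (𝕜 := ℝ)
        (fun x _ => Real.differentiableAt_exp) fun x hx => ?_
      rw [Real.deriv_exp, ← NNReal.coe_le_coe, coe_nnnorm, Real.norm_eq_abs, Real.abs_exp]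
      exact Real.exp_le_one_iff.mpr hx
    have h3 := h2.comp h1 fun u hu => by simpa using hG0 u hu
    rw [← hu] at h3
    exact h3.absolutelyContinuousOnInterval
  have hhac : AbsolutelyContinuousOnInterval h s T := by
    have h1 := (hq.absolutelyContinuousOnInterval_intervalIntegral (c := T) (by simp)).neg
    have h2 : AbsolutelyContinuousOnInterval (fun _ => c) s T :=
      (LipschitzWith.const c).lipschitzOnWith.absolutelyContinuousOnInterval
    have h3 : h = (fun _ => c) + -fun x => ∫ v in T..x, q v := by
      funext u
      simp only [hh, Pi.add_apply, Pi.neg_apply]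
      rw [intervalIntegral.integral_symm]
    rw [h3]
    exact h2.add h1
  have key := hgac.integral_deriv_mul_eq_sub hhac
  have hint : ∫ u in s..T, g u * (q u + E u * f u) =
      - ∫ u in s..T, deriv g u * h u + g u * deriv h u := by
    rw [← intervalIntegral.integral_neg]
    refine intervalIntegral.integral_congr_ae ?_
    filter_upwards [hEI.ae_hasDerivAt_integral, hq.ae_hasDerivAt_integral] with u h1 h2 hu'
    have hu1 : u ∈ uIcc s T := uIoc_subset_uIcc hu'
    have hd1 : HasDerivAt g (g u * (-E u)) u := (h1 hu1 s (by simp)).neg.exp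
    have hd2 : HasDerivAt h (-q u) u := by
      have := ((h2 hu1 T (by simp)).neg).const_add c
      refine this.congr_of_eventuallyEq (Eventually.of_forall fun x => ?_)
      simp [hh, intervalIntegral.integral_symm x T]
    rw [hd1.deriv, hd2.deriv, hf u (hu ▸ hu1)]
    simp only [hh]
    ring
  rw [hint, key]
  have hs : f s = h s := hf s ⟨le_rfl, hsT⟩
  have ht : f T = h T := hf T ⟨hsT, le_rfl⟩
  rw [hs, ht]
  simp [hg]

/-! ### Existence and uniqueness for the Bellman equations -/

/-- A function that does not increase while it lies above `c` stays below `c`. -/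
theorem le_of_deriv_nonpos_above {y y' : ℝ → ℝ} {T c : ℝ}
    (hy : ContinuousOn y (Icc 0 T))
    (hd : ∀ s ∈ Ico 0 T, HasDerivWithinAt y (y' s) (Ici s) s) (h0 : y 0 ≤ c)
    (hc : ∀ s ∈ Ico 0 T, c < y s → y' s ≤ 0) : ∀ s ∈ Icc 0 T, y s ≤ c := by
  intro s hs
  have key : ∀ ε > 0, y s ≤ c + ε * (1 + s) := by
    intro ε hε
    refine image_le_of_deriv_right_lt_deriv_boundary (B := fun s => c + ε * (1 + s))
      (B' := fun _ => ε) hy hd (by simp; linarith) (fun x => ?_) (fun x hx heq => ?_) hs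
    · simpa using (((hasDerivAt_id x).const_add 1).const_mul ε).const_add c
    · refine lt_of_le_of_lt (hc x hx ?_) hε
      have : 0 < ε * (1 + x) := mul_pos hε (by linarith [hx.1])
      linarith
  refine le_of_forall_pos_le_add fun δ hδ => ?_
  have h1 : 0 < 1 + s := by linarith [hs.1]
  have := key (δ / (1 + s)) (by positivity)
  rwa [div_mul_cancel₀ _ h1.ne'] at this

noncomputable section

namespace CTMDP

variable {L A : Type*} [Fintype L] [Fintype A] (M : CTMDP L A)

/-- A bound on all exit rates. -/
def rateBound : ℝ := ∑ l, ∑ a, (M.exit l a : ℝ)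

theorem exit_le_rateBound (l : L) (a : A) : (M.exit l a : ℝ) ≤ M.rateBound :=
  (Finset.single_le_sum (f := fun a => (M.exit l a : ℝ)) (fun _ _ => NNReal.coe_nonneg _)
    (Finset.mem_univ a)).trans
    (Finset.single_le_sum (f := fun l => ∑ a, (M.exit l a : ℝ))
      (fun _ _ => Finset.sum_nonneg fun _ _ => NNReal.coe_nonneg _) (Finset.mem_univ l))

theorem rateBound_nonneg : 0 ≤ M.rateBound :=
  Finset.sum_nonneg fun _ _ => Finset.sum_nonneg fun _ _ => NNReal.coe_nonneg _

theorem coe_exit (l : L) (a : A) : (M.exit l a : ℝ) = ∑ l', (M.rate l a l' : ℝ) := by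
  simp [exit]

instance enabled_nonempty (l : L) : Nonempty {a // M.Enabled l a} := by
  obtain ⟨a, ha⟩ := M.exists_enabled l
  exact ⟨⟨a, ha⟩⟩

/-- The right-hand side of the Bellman equation, as a function of the vector of values. -/
def bellman (x : L → ℝ) (l : L) : ℝ :=
  ⨆ a : {a // M.Enabled l a}, ∑ l', (M.rate l a l' : ℝ) * (x l' - x l)

theorem iSup_gain_eq_bellman (f : L → ℝ → ℝ) (l : L) (t : ℝ) :
    ⨆ a : {a // M.Enabled l a}, M.gain f l a t = M.bellman (fun l => f l t) l := rfl

theorem le_bellman (x : L → ℝ) {l : L} {a : A} (ha : M.Enabled l a) :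
    ∑ l', (M.rate l a l' : ℝ) * (x l' - x l) ≤ M.bellman x l :=
  le_ciSup (f := fun a : {a // M.Enabled l a} => ∑ l', (M.rate l a l' : ℝ) * (x l' - x l))
    (Set.finite_range _).bddAbove ⟨a, ha⟩

theorem exists_eq_bellman (x : L → ℝ) (l : L) :
    ∃ a, M.Enabled l a ∧ ∑ l', (M.rate l a l' : ℝ) * (x l' - x l) = M.bellman x l := by
  obtain ⟨a, ha⟩ := exists_eq_ciSup_of_finite
    (f := fun a : {a // M.Enabled l a} => ∑ l', (M.rate l a l' : ℝ) * (x l' - x l))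
  exact ⟨a, a.2, ha⟩

theorem bellman_le_add (x y : L → ℝ) (l : L) :
    M.bellman x l ≤ M.bellman y l + M.rateBound * (2 * ‖x - y‖) := by
  refine ciSup_le fun a => ?_
  have h1 := M.le_bellman y a.2
  have h2 : ∑ l', (M.rate l a l' : ℝ) * (x l' - x l) ≤
      ∑ l', (M.rate l a l' : ℝ) * (y l' - y l) + ∑ l', (M.rate l a l' : ℝ) * (2 * ‖x - y‖) := by
    rw [← Finset.sum_add_distrib]
    refine Finset.sum_le_sum fun l' _ => ?_
    rw [← mul_add]
    refine mul_le_mul_of_nonneg_left ?_ (NNReal.coe_nonneg _)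
    have ha := (abs_le.mp (norm_le_pi_norm (x - y) l')).2
    have hb := (abs_le.mp (norm_le_pi_norm (x - y) l)).1
    simp only [Pi.sub_apply] at ha hb
    linarith
  rw [← Finset.sum_mul, ← M.coe_exit] at h2
  have h3 := mul_le_mul_of_nonneg_right (M.exit_le_rateBound l a)
    (by positivity : 0 ≤ 2 * ‖x - y‖)
  linarith

theorem dist_bellman_le (x y : L → ℝ) (l : L) :
    |M.bellman x l - M.bellman y l| ≤ 2 * M.rateBound * ‖x - y‖ := by
  have h1 := M.bellman_le_add x y l
  have h2 := M.bellman_le_add y x l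
  rw [norm_sub_rev] at h2
  rw [abs_le]
  constructor <;> linarith

theorem lipschitzWith_bellman : LipschitzWith (2 * M.rateBound).toNNReal M.bellman := by
  refine LipschitzWith.of_dist_le_mul fun x y => ?_
  have := M.rateBound_nonneg
  rw [Real.coe_toNNReal _ (by positivity), dist_pi_le_iff (by positivity)]
  intro l
  rw [Real.dist_eq, dist_eq_norm]
  exact M.dist_bellman_le x y l

/-- The Bellman operator after clamping all values to `[0,1]`, and switched off on the goal
region. It is bounded, so that its flow exists globally, and agrees with the Bellman operator along
that flow. -/
def clampedBellman (x : L → ℝ) (l : L) : ℝ := by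
  classical exact if l ∈ M.goal then 0 else M.bellman (fun l => max 0 (min 1 (x l))) l

theorem abs_clampedBellman_le (x : L → ℝ) (l : L) : |M.clampedBellman x l| ≤ M.rateBound := by
  unfold clampedBellman
  split_ifs with hl
  · simpa using M.rateBound_nonneg
  · obtain ⟨a, -, ha⟩ := M.exists_eq_bellman (fun l => max 0 (min 1 (x l))) l
    rw [← ha]
    refine (Finset.abs_sum_le_sum_abs _ _).trans ?_
    refine le_trans (Finset.sum_le_sum (g := fun l' => (M.rate l a l' : ℝ)) fun l' _ => ?_) ?_
    · rw [abs_mul, NNReal.abs_eq]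
      refine mul_le_of_le_one_right (NNReal.coe_nonneg _) ?_
      have h1 : ∀ r : ℝ, max 0 (min 1 r) ∈ Icc (0 : ℝ) 1 := fun r =>
        ⟨le_max_left _ _, max_le zero_le_one (min_le_left _ _)⟩
      have h2 := h1 (x l)
      have h3 := h1 (x l')
      rw [abs_le]
      constructor <;> linarith [h2.1, h2.2, h3.1, h3.2]
    · rw [← M.coe_exit]
      exact M.exit_le_rateBound l a

theorem lipschitzWith_clampedBellman :
    LipschitzWith (2 * M.rateBound).toNNReal M.clampedBellman := by
  refine LipschitzWith.of_dist_le_mul fun x y => ?_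
  have := M.rateBound_nonneg
  rw [Real.coe_toNNReal _ (by positivity), dist_pi_le_iff (by positivity)]
  intro l
  rw [Real.dist_eq, dist_eq_norm]
  unfold clampedBellman
  split_ifs with hl
  · simp; positivity
  · refine (M.dist_bellman_le _ _ l).trans (mul_le_mul_of_nonneg_left ?_ (by positivity))
    rw [pi_norm_le_iff_of_nonneg (norm_nonneg _)]
    intro l'
    refine le_trans ?_ (norm_le_pi_norm (x - y) l')
    simp only [Pi.sub_apply, Real.norm_eq_abs]
    refine (abs_max_sub_max_le_max _ _ _ _).trans ?_
    simp only [sub_self, abs_zero]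
    refine max_le (abs_nonneg _) ((abs_min_sub_min_le_max _ _ _ _).trans ?_)
    simp

/-- The gains vanish in the goal region if the values are one there, since it is absorbing. -/
theorem bellman_goal {x : L → ℝ} (hx : ∀ l ∈ M.goal, x l = 1) {l : L} (hl : l ∈ M.goal) :
    M.bellman x l = 0 := by
  obtain ⟨a, -, ha⟩ := M.exists_eq_bellman x l
  rw [← ha]
  refine Finset.sum_eq_zero fun l' _ => ?_
  by_cases hl' : l' ∈ M.goal
  · simp [hx l hl, hx l' hl']
  · simp [M.goal_absorbing l hl a l' hl']

/-- The flow of the Bellman operator started in the indicator function of the goal region (that is,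
the solution of the Bellman equations as a function of the remaining time). -/
theorem exists_bellman_flow {T : ℝ} (hT : 0 ≤ T) : ∃ y : ℝ → L → ℝ,
    (∀ l ∈ M.goal, y 0 l = 1) ∧ (∀ l ∉ M.goal, y 0 l = 0) ∧
    (∀ t ∈ Icc 0 T, HasDerivWithinAt y (M.bellman (y t)) (Icc 0 T) t) ∧
    (∀ l ∈ M.goal, ∀ t ∈ Icc 0 T, y t l = 1) ∧
    ∀ t ∈ Icc 0 T, ∀ l, y t l ∈ Icc (0 : ℝ) 1 := by
  classical
  have hC := M.rateBound_nonneg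
  let y₀ : L → ℝ := fun l => if l ∈ M.goal then 1 else 0
  have hPL : IsPicardLindelof (fun _ : ℝ => M.clampedBellman) (tmin := 0) (tmax := T)
      ⟨0, le_rfl, hT⟩ y₀ (M.rateBound * T).toNNReal 0 M.rateBound.toNNReal
      (2 * M.rateBound).toNNReal := by
    refine ⟨fun t _ => M.lipschitzWith_clampedBellman.lipschitzOnWith,
      fun x _ => continuousOn_const, fun t _ x _ => ?_, ?_⟩
    · rw [Real.coe_toNNReal _ hC, pi_norm_le_iff_of_nonneg hC]
      exact M.abs_clampedBellman_le x
    · rw [Real.coe_toNNReal _ hC, Real.coe_toNNReal _ (by positivity)]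
      simp [hT]
  obtain ⟨y, hy0, hyd⟩ := hPL.exists_eq_forall_mem_Icc_hasDerivWithinAt₀
  simp only at hy0
  have hd : ∀ l, ∀ t ∈ Icc 0 T,
      HasDerivWithinAt (fun t => y t l) (M.clampedBellman (y t) l) (Icc 0 T) t :=
    fun l t ht => hasDerivWithinAt_pi.mp (hyd t ht) l
  have hcont : ∀ l, ContinuousOn (fun t => y t l) (Icc 0 T) :=
    fun l t ht => (hd l t ht).continuousWithinAt
  have hd' : ∀ l, ∀ t ∈ Ico 0 T,
      HasDerivWithinAt (fun t => y t l) (M.clampedBellman (y t) l) (Ici t) t :=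
    fun l t ht => (hd l t ⟨ht.1, ht.2.le⟩).mono_of_mem_nhdsWithin
      (mem_of_superset (Icc_mem_nhdsGE ht.2) (Icc_subset_Icc ht.1 le_rfl))
  have hub : ∀ l, ∀ t ∈ Icc 0 T, y t l ≤ 1 := by
    intro l
    refine le_of_deriv_nonpos_above (hcont l) (hd' l) ?_ fun s hs h1 => ?_
    · rw [hy0]
      simp only [y₀]
      split_ifs <;> simp
    · unfold clampedBellman
      split_ifs with hl
      · exact le_rfl
      · refine ciSup_le fun a => Finset.sum_nonpos fun l' _ => ?_
        refine mul_nonpos_of_nonneg_of_nonpos (NNReal.coe_nonneg _) ?_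
        dsimp only
        rw [min_eq_left h1.le, max_eq_right zero_le_one, sub_nonpos]
        exact max_le zero_le_one (min_le_left _ _)
  have hlb : ∀ l, ∀ t ∈ Icc 0 T, -y t l ≤ 0 := by
    intro l
    refine le_of_deriv_nonpos_above (hcont l).neg (fun s hs => (hd' l s hs).neg) ?_
      fun s hs h1 => ?_
    · rw [hy0]
      simp only [y₀]
      split_ifs <;> simp
    · rw [neg_nonpos]
      unfold clampedBellman
      split_ifs with hl
      · exact le_rfl
      · obtain ⟨a, -, ha⟩ := M.exists_eq_bellman (fun l => max 0 (min 1 (y s l))) l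
        rw [← ha]
        refine Finset.sum_nonneg fun l' _ => mul_nonneg (NNReal.coe_nonneg _) ?_
        have h2 : y s l < 0 := by linarith
        rw [min_eq_right (h2.le.trans zero_le_one), max_eq_left h2.le, sub_zero]
        exact le_max_left _ _
  have hgoal : ∀ l ∈ M.goal, ∀ t ∈ Icc 0 T, y t l = 1 := by
    intro l hl t ht
    have hz : ∀ x ∈ Ico 0 T, HasDerivWithinAt (fun t => y t l) 0 (Ici x) x := by
      intro x hx
      have := hd' l x hx
      rwa [clampedBellman, if_pos hl] at this
    have := constant_of_has_deriv_right_zero (hcont l) hz t ht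
    rw [this, hy0]
    simp [y₀, hl]
  refine ⟨y, fun l hl => by simp [hy0, y₀, hl], fun l hl => by simp [hy0, y₀, hl],
    fun t ht => ?_, hgoal, fun t ht l => ⟨by linarith [hlb l t ht], hub l t ht⟩⟩
  have heq : M.clampedBellman (y t) = M.bellman (y t) := by
    ext l
    unfold clampedBellman
    split_ifs with hl
    · exact (M.bellman_goal (fun l hl => hgoal l hl t ht) hl).symm
    · congr 1
      ext l'
      rw [min_eq_right (hub l' t ht), max_eq_right (by linarith [hlb l' t ht])]
  rw [← heq]
  exact hyd t ht

/-- The Bellman equations have a solution with values in `[0,1]`. It is extended continuously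
to all points in time. -/
theorem exists_isBellmanMax {T : ℝ} (hT : 0 ≤ T) : ∃ f : L → ℝ → ℝ, M.IsBellmanMax T f ∧
    (∀ l, Continuous (f l)) ∧ ∀ l t, f l t ∈ Icc (0 : ℝ) 1 := by
  obtain ⟨y, h1, h2, hd, hg, h01⟩ := M.exists_bellman_flow hT
  -- the remaining time, clamped to `[0,T]`
  let r : ℝ → ℝ := fun t => T - projIcc 0 T hT t
  have hr : ∀ t, r t ∈ Icc 0 T := fun t => by
    have := (projIcc 0 T hT t).2
    exact ⟨by simp [r, this.2], by simp [r, this.1]⟩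
  have hrt : ∀ t ∈ Icc 0 T, r t = T - t := fun t ht => by simp [r, projIcc_of_mem hT ht]
  have hyc : ContinuousOn y (Icc 0 T) := fun t ht => (hd t ht).continuousWithinAt
  refine ⟨fun l t => y (r t) l, ⟨fun l hl t ht => hg l hl _ (hr t), fun l hl => ?_,
    fun l t ht => ?_⟩, fun l => ?_, fun l t => h01 _ (hr t) l⟩
  · rw [hrt T ⟨hT, le_rfl⟩, sub_self]
    exact h2 l hl
  · rw [iSup_gain_eq_bellman]
    have ht' : T - t ∈ Icc 0 T := hrt t ht ▸ hr t
    have hs : HasDerivWithinAt (fun t => T - t) (-1) (Icc 0 T) t := by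
      simpa using ((hasDerivAt_id t).const_sub T).hasDerivWithinAt
    have := (hasDerivWithinAt_pi.mp (hd _ ht') l).comp t hs
      (fun u hu => ⟨by linarith [hu.2], by linarith [hu.1]⟩)
    simp only [mul_neg, mul_one] at this
    have hcongr := this.congr (f₁ := fun t => y (r t) l) (fun u hu => by simp [hrt u hu])
      (by simp [hrt t ht])
    simpa [hrt t ht] using hcongr
  · have hrc : Continuous r := by fun_prop
    exact (continuous_apply l).comp (hyc.comp_continuous hrc hr)

theorem IsBellmanMax.eqOn {T : ℝ} {f g : L → ℝ → ℝ} (hf : M.IsBellmanMax T f)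
    (hg : M.IsBellmanMax T g) (l : L) {t : ℝ} (ht : t ∈ Icc 0 T) : f l t = g l t := by
  have aux : ∀ {f : L → ℝ → ℝ}, M.IsBellmanMax T f → ∀ t ∈ Icc 0 T,
      HasDerivWithinAt (fun t l => f l t) (-M.bellman fun l => f l t) (Icc 0 T) t :=
    fun hf t ht => hasDerivWithinAt_pi.mpr fun l => hf.deriv l t ht
  have hl : ∀ t ∈ Ioc 0 T, Icc 0 T ∈ 𝓝[≤] t := fun t ht =>
    mem_of_superset (Icc_mem_nhdsLE ht.1) (Icc_subset_Icc le_rfl ht.2)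
  have := ODE_solution_unique_of_mem_Icc_left (v := fun _ x => -M.bellman x) (s := fun _ => univ)
    (K := (2 * M.rateBound).toNNReal) (a := 0) (b := T) (f := fun t l => f l t)
    (g := fun t l => g l t)
    (fun t _ => M.lipschitzWith_bellman.neg.lipschitzOnWith)
    (fun t ht => (aux hf t ht).continuousWithinAt)
    (fun t ht => (aux hf t ⟨ht.1.le, ht.2⟩).mono_of_mem_nhdsWithin (hl t ht))
    (fun _ _ => mem_univ _)
    (fun t ht => (aux hg t ht).continuousWithinAt)
    (fun t ht => (aux hg t ⟨ht.1.le, ht.2⟩).mono_of_mem_nhdsWithin (hl t ht))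
    (fun _ _ => mem_univ _) ?_
  · exact congrFun (this ht) l
  · have hT : T ∈ Icc 0 T := ⟨ht.1.trans ht.2, le_rfl⟩
    ext l
    by_cases hG : l ∈ M.goal
    · rw [hf.goal l hG T hT, hg.goal l hG T hT]
    · rw [hf.final l hG, hg.final l hG]

end CTMDP

end

/-! ### Path densities as products over the transitions -/

namespace TimedPath

variable {L A : Type*}

/-- The point in time at which the last location of the path is entered, for a path that starts at
time `t₀`. -/
def lastEntry (t₀ : ℝ) (π : TimedPath L A) : ℝ := π.entry t₀ (Fin.last _)

/-- The path `π` followed by a transition at time `u` to `l'` under action `a`. -/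
def extend (π : TimedPath L A) (a : A) (l' : L) (u : ℝ) : TimedPath L A :=
  ⟨⟨π.1.len + 1, Fin.snoc (α := fun _ => L) π.1.loc l', Fin.snoc (α := fun _ => A) π.1.act a⟩,
    Fin.snoc (α := fun _ => ℝ) π.2 u⟩

@[simp]
theorem last_extend (π : TimedPath L A) (a : A) (l' : L) (u : ℝ) : (π.extend a l' u).last = l' :=
  Fin.snoc_last (α := fun _ => L) _ _

theorem lastEntry_mk_succ (t₀ : ℝ) {n : ℕ} (loc : Fin (n + 2) → L) (act : Fin (n + 1) → A)
    (τ : Fin (n + 1) → ℝ) :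
    lastEntry t₀ (⟨⟨n + 1, loc, act⟩, τ⟩ : TimedPath L A) = τ (Fin.last n) := by
  simp only [lastEntry, entry, ← Fin.succ_last, Fin.cons_succ]

@[simp]
theorem lastEntry_extend (t₀ : ℝ) (π : TimedPath L A) (a : A) (l' : L) (u : ℝ) :
    (π.extend a l' u).lastEntry t₀ = u := by
  rw [extend, lastEntry_mk_succ, Fin.snoc_last]

theorem measurable_lastEntry (t₀ : ℝ) (s : Skeleton L A) :
    Measurable fun τ => lastEntry t₀ (⟨s, τ⟩ : TimedPath L A) := by
  obtain ⟨n, loc, act⟩ := s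
  cases n with
  | zero => exact measurable_const
  | succ n =>
    simp only [lastEntry_mk_succ]
    exact measurable_pi_apply _

theorem cons_castSucc_eq_cons_init {n : ℕ} (t₀ : ℝ) (τ : Fin (n + 1) → ℝ) (j : Fin (n + 1)) :
    (Fin.cons t₀ τ : Fin (n + 2) → ℝ) j.castSucc =
      (Fin.cons t₀ (Fin.init τ) : Fin (n + 1) → ℝ) j := by
  refine Fin.cases ?_ (fun k => ?_) j
  · simp
  · rw [← Fin.succ_castSucc, Fin.cons_succ, Fin.cons_succ]
    rfl

theorem valid_iff {T t₀ : ℝ} {n : ℕ} {loc : Fin (n + 1) → L} {act : Fin n → A} {τ : Fin n → ℝ} :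
    Valid T t₀ (⟨⟨n, loc, act⟩, τ⟩ : TimedPath L A) ↔
      t₀ ≤ T ∧ ∀ i : Fin n, (Fin.cons t₀ τ : Fin (n + 1) → ℝ) i.castSucc ≤ τ i ∧ τ i ≤ T := by
  simp only [Valid, entry, Fin.monotone_iff_le_succ, Fin.forall_fin_succ, Fin.cons_zero,
    Fin.cons_succ, forall_and]
  tauto

theorem valid_succ_iff {T t₀ : ℝ} {n : ℕ} {loc : Fin (n + 2) → L} {act : Fin (n + 1) → A}
    {τ : Fin (n + 1) → ℝ} :
    Valid T t₀ (⟨⟨n + 1, loc, act⟩, τ⟩ : TimedPath L A) ↔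
      Valid T t₀ (⟨⟨n, Fin.init loc, Fin.init act⟩, Fin.init τ⟩ : TimedPath L A) ∧
        τ (Fin.last n) ∈ Icc (lastEntry t₀
          (⟨⟨n, Fin.init loc, Fin.init act⟩, Fin.init τ⟩ : TimedPath L A)) T := by
  rw [valid_iff, valid_iff, Fin.forall_fin_succ']
  simp only [cons_castSucc_eq_cons_init, and_assoc, mem_Icc]
  rfl

end TimedPath

noncomputable section

namespace CTMDP

variable {L A : Type*} [Fintype L] [Fintype A] (M : CTMDP L A)

/-- The Borel part of measurability of a scheduler. -/
def THRScheduler.IsBorel {M : CTMDP L A} (σ : M.THRScheduler) : Prop :=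
  ∀ (s : Skeleton L A) (a : A),
    Measurable fun p : (Fin s.len → ℝ) × ℝ => σ.prob ⟨s, p.1⟩ p.2 a

section

variable (T : ℝ) (σ : M.THRScheduler)

/-- The density of the next transition on the history `π`, whose last location is entered at time
`s`, being at time `u` to `l'` under action `a`. -/
def stepDensity (s : ℝ) (π : TimedPath L A) (a : A) (l' : L) (u : ℝ) : ℝ≥0∞ :=
  (Icc s T).indicator
    (fun u => ENNReal.ofReal (M.survival σ π s u * (σ.prob π u a * M.rate π.last a l'))) u

/-- The density of the timed paths with a given prefix: `pathDensity` without the requirement that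
no further transition occurs. -/
def weight (t₀ : ℝ) : (n : ℕ) → (Fin (n + 1) → L) → (Fin n → A) → (Fin n → ℝ) → ℝ≥0∞
  | 0, _, _, _ => 1
  | n + 1, loc, act, τ =>
    weight t₀ n (Fin.init loc) (Fin.init act) (Fin.init τ) *
      M.stepDensity T σ
        (TimedPath.lastEntry t₀ ⟨⟨n, Fin.init loc, Fin.init act⟩, Fin.init τ⟩)
        ⟨⟨n, Fin.init loc, Fin.init act⟩, Fin.init τ⟩
        (act (Fin.last n)) (loc (Fin.last (n + 1))) (τ (Fin.last n))

theorem survival_nonneg (π : TimedPath L A) (s t : ℝ) : 0 ≤ M.survival σ π s t :=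
  (Real.exp_pos _).le

/-- The factor of the `i`-th transition in the density of a path. -/
def pathFactor (t₀ : ℝ) (π : TimedPath L A) (i : Fin π.1.len) : ℝ :=
  M.survival σ (π.take i.castSucc) (π.entry t₀ i.castSucc) (π.entry t₀ i.succ) *
    (σ.prob (π.take i.castSucc) (π.entry t₀ i.succ) (π.1.act i) *
      M.rate (π.1.loc i.castSucc) (π.1.act i) (π.1.loc i.succ))

theorem pathFactor_nonneg (t₀ : ℝ) (π : TimedPath L A) (i : Fin π.1.len) :
    0 ≤ M.pathFactor σ t₀ π i :=
  mul_nonneg (M.survival_nonneg σ _ _ _) (by positivity)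

theorem pathFactor_castSucc (t₀ : ℝ) {n : ℕ} (loc : Fin (n + 2) → L) (act : Fin (n + 1) → A)
    (τ : Fin (n + 1) → ℝ) (i : Fin n) :
    M.pathFactor σ t₀ ⟨⟨n + 1, loc, act⟩, τ⟩ i.castSucc =
      M.pathFactor σ t₀ ⟨⟨n, Fin.init loc, Fin.init act⟩, Fin.init τ⟩ i := by
  have h1 : TimedPath.entry t₀ (⟨⟨n + 1, loc, act⟩, τ⟩ : TimedPath L A) i.castSucc.castSucc =
      TimedPath.entry t₀ (⟨⟨n, Fin.init loc, Fin.init act⟩, Fin.init τ⟩ : TimedPath L A)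
        i.castSucc := TimedPath.cons_castSucc_eq_cons_init t₀ τ _
  have h2 : TimedPath.entry t₀ (⟨⟨n + 1, loc, act⟩, τ⟩ : TimedPath L A) i.castSucc.succ =
      TimedPath.entry t₀ (⟨⟨n, Fin.init loc, Fin.init act⟩, Fin.init τ⟩ : TimedPath L A)
        i.succ := TimedPath.cons_castSucc_eq_cons_init t₀ τ i.succ
  simp only [pathFactor]
  rw [h1, h2]
  rfl

open scoped Classical in
/-- The recursive definition of `weight` unfolds to the product in the definition of
`pathDensity`; the indicators in the factors together express validity of the path. -/
theorem weight_eq_prod {t₀ : ℝ} (h₀ : t₀ ≤ T) (n : ℕ) (loc : Fin (n + 1) → L) (act : Fin n → A)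
    (τ : Fin n → ℝ) :
    M.weight T σ t₀ n loc act τ =
      if TimedPath.Valid T t₀ (⟨⟨n, loc, act⟩, τ⟩ : TimedPath L A) then
        ENNReal.ofReal (∏ i, M.pathFactor σ t₀ ⟨⟨n, loc, act⟩, τ⟩ i) else 0 := by
  induction n with
  | zero =>
    rw [if_pos (TimedPath.valid_iff.mpr ⟨h₀, fun i => i.elim0⟩)]
    simp [weight]
  | succ n ih =>
    rw [weight, ih, Fin.prod_univ_castSucc]
    simp only [pathFactor_castSucc, TimedPath.valid_succ_iff, stepDensity]
    by_cases hv : TimedPath.Valid T t₀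
        (⟨⟨n, Fin.init loc, Fin.init act⟩, Fin.init τ⟩ : TimedPath L A)
    · by_cases hm : τ (Fin.last n) ∈ Icc (TimedPath.lastEntry t₀
          (⟨⟨n, Fin.init loc, Fin.init act⟩, Fin.init τ⟩ : TimedPath L A)) T
      · rw [if_pos hv, if_pos ⟨hv, hm⟩, indicator_of_mem hm,
          ← ENNReal.ofReal_mul (Finset.prod_nonneg fun i _ => M.pathFactor_nonneg σ t₀
            ⟨⟨n, Fin.init loc, Fin.init act⟩, Fin.init τ⟩ i)]
        congr 2
        have h1 : TimedPath.entry t₀ (⟨⟨n + 1, loc, act⟩, τ⟩ : TimedPath L A)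
            (Fin.last n).castSucc = TimedPath.lastEntry t₀
              (⟨⟨n, Fin.init loc, Fin.init act⟩, Fin.init τ⟩ : TimedPath L A) :=
          TimedPath.cons_castSucc_eq_cons_init t₀ τ _
        simp only [pathFactor]
        rw [h1]
        rfl
      · rw [if_pos hv, if_neg (fun h => hm h.2), indicator_of_notMem hm, mul_zero]
    · rw [if_neg hv, if_neg (fun h => hv h.1), zero_mul]

theorem ofReal_pathDensity {t₀ : ℝ} (h₀ : t₀ ≤ T) (n : ℕ) (loc : Fin (n + 1) → L)
    (act : Fin n → A) (τ : Fin n → ℝ) :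
    ENNReal.ofReal (M.pathDensity T σ t₀ ⟨⟨n, loc, act⟩, τ⟩) =
      M.weight T σ t₀ n loc act τ * ENNReal.ofReal (M.survival σ ⟨⟨n, loc, act⟩, τ⟩
        (TimedPath.lastEntry t₀ ⟨⟨n, loc, act⟩, τ⟩) T) := by
  classical
  rw [M.weight_eq_prod T σ h₀, pathDensity]
  split_ifs with hv
  · rw [← ENNReal.ofReal_mul (Finset.prod_nonneg fun i _ => M.pathFactor_nonneg σ t₀ _ i)]
    rfl
  · simp

/-- Paths that leave the goal region have density zero. -/
theorem weight_eq_zero_of_leaves_goal (t₀ : ℝ) (n : ℕ) (loc : Fin (n + 1) → L) (act : Fin n → A)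
    (τ : Fin n → ℝ) (hi : ∃ i, loc i ∈ M.goal) (hl : loc (Fin.last n) ∉ M.goal) :
    M.weight T σ t₀ n loc act τ = 0 := by
  induction n with
  | zero =>
    obtain ⟨i, hi⟩ := hi
    rw [Subsingleton.elim (α := Fin 1) i (Fin.last 0)] at hi
    exact absurd hi hl
  | succ n ih =>
    rw [weight]
    -- either the last transition leaves the goal region, or an earlier one does
    by_cases hlast : Fin.init loc (Fin.last n) ∈ M.goal
    · have : M.rate (Fin.init loc (Fin.last n)) (act (Fin.last n)) (loc (Fin.last (n + 1))) = 0 :=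
        M.goal_absorbing _ hlast _ _ hl
      simp only [stepDensity, TimedPath.last]
      rw [this]
      simp
    · rw [ih _ _ _ _ hlast, zero_mul]
      obtain ⟨i, hi⟩ := hi
      refine Fin.lastCases (fun h => absurd h hl) (fun j h => ⟨j, h⟩) i hi

/-! ### Measurability of the densities -/

variable {T σ}

theorem exitRate_nonneg (π : TimedPath L A) (u : ℝ) : 0 ≤ M.exitRate σ π u :=
  Finset.sum_nonneg fun _ _ => by positivity

theorem sum_coe_prob (π : TimedPath L A) (u : ℝ) : ∑ a, (σ.prob π u a : ℝ) = 1 := by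
  exact_mod_cast σ.sum_prob π u

theorem exitRate_le (π : TimedPath L A) (u : ℝ) : M.exitRate σ π u ≤ M.rateBound := by
  calc M.exitRate σ π u ≤ ∑ a, (σ.prob π u a : ℝ) * M.rateBound :=
        Finset.sum_le_sum fun a _ =>
          mul_le_mul_of_nonneg_left (M.exit_le_rateBound _ _) (NNReal.coe_nonneg _)
    _ = M.rateBound := by rw [← Finset.sum_mul, M.sum_coe_prob, one_mul]

theorem survival_le_one (π : TimedPath L A) {s t : ℝ} (h : s ≤ t) : M.survival σ π s t ≤ 1 :=
  Real.exp_le_one_iff.mpr (neg_nonpos.mpr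
    (intervalIntegral.integral_nonneg h fun u _ => M.exitRate_nonneg π u))

theorem measurable_exitRate (hσ : σ.IsBorel) (s : Skeleton L A) :
    Measurable fun p : (Fin s.len → ℝ) × ℝ => M.exitRate σ ⟨s, p.1⟩ p.2 :=
  Finset.measurable_sum _ fun a _ =>
    (hσ s a).coe_nnreal_real.mul_const (M.exit (s.loc (Fin.last _)) a : ℝ)

theorem measurable_exitRate_right (hσ : σ.IsBorel) (π : TimedPath L A) :
    Measurable (M.exitRate σ π) :=
  (M.measurable_exitRate hσ π.1).comp (measurable_const.prodMk measurable_id)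

theorem _root_.Measurable.intervalIntegral_param {X : Type*} [MeasurableSpace X]
    {F : X → ℝ → ℝ} (hF : Measurable fun p : X × ℝ => F p.1 p.2) :
    Measurable fun p : X × ℝ × ℝ => ∫ v in p.2.1..p.2.2, F p.1 v := by
  have aux : ∀ a b : X × ℝ × ℝ → ℝ, Measurable a → Measurable b →
      Measurable fun p : X × ℝ × ℝ => ∫ v in Ioc (a p) (b p), F p.1 v := by
    intro a b ha hb
    simp only [← integral_indicator measurableSet_Ioc]
    refine (StronglyMeasurable.integral_prod_right (ν := volume)
      (f := fun (p : X × ℝ × ℝ) v => (Ioc (a p) (b p)).indicator (F p.1) v)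
      (Measurable.stronglyMeasurable ?_)).measurable
    have hs : MeasurableSet {q : (X × ℝ × ℝ) × ℝ | q.2 ∈ Ioc (a q.1) (b q.1)} :=
      (measurableSet_lt (ha.comp measurable_fst) measurable_snd).inter
        (measurableSet_le measurable_snd (hb.comp measurable_fst))
    have hF' : Measurable fun q : (X × ℝ × ℝ) × ℝ => F q.1.1 q.2 :=
      hF.comp ((measurable_fst.comp measurable_fst).prodMk measurable_snd)
    exact hF'.indicator hs
  simp only [intervalIntegral]
  exact (aux _ _ (by fun_prop) (by fun_prop)).sub (aux _ _ (by fun_prop) (by fun_prop))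

theorem measurable_survival (hσ : σ.IsBorel) (s : Skeleton L A) :
    Measurable fun p : (Fin s.len → ℝ) × ℝ × ℝ => M.survival σ ⟨s, p.1⟩ p.2.1 p.2.2 :=
  Real.measurable_exp.comp (Measurable.intervalIntegral_param
    (F := fun τ u => M.exitRate σ ⟨s, τ⟩ u) (M.measurable_exitRate hσ s)).neg

theorem measurable_stepDensity (hσ : σ.IsBorel) (t₀ : ℝ) (s : Skeleton L A) (a : A) (l' : L) :
    Measurable fun p : (Fin s.len → ℝ) × ℝ =>
      M.stepDensity T σ (TimedPath.lastEntry t₀ ⟨s, p.1⟩) ⟨s, p.1⟩ a l' p.2 := by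
  have hl := (TimedPath.measurable_lastEntry t₀ s).comp
    (measurable_fst : Measurable (Prod.fst : (Fin s.len → ℝ) × ℝ → _))
  have hs : MeasurableSet {p : (Fin s.len → ℝ) × ℝ |
      p.2 ∈ Icc (TimedPath.lastEntry t₀ (⟨s, p.1⟩ : TimedPath L A)) T} :=
    (measurableSet_le hl measurable_snd).inter (measurableSet_le measurable_snd measurable_const)
  have h1 := (M.measurable_survival hσ s).comp
    (measurable_fst.prodMk (hl.prodMk measurable_snd))
  have h2 : Measurable fun p : (Fin s.len → ℝ) × ℝ => ENNReal.ofReal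
      (M.survival σ ⟨s, p.1⟩ (TimedPath.lastEntry t₀ ⟨s, p.1⟩) p.2 *
        (σ.prob ⟨s, p.1⟩ p.2 a * M.rate (TimedPath.last ⟨s, p.1⟩) a l')) :=
    (h1.mul ((hσ s a).coe_nnreal_real.mul_const (M.rate (s.loc (Fin.last _)) a l'))).ennreal_ofReal
  exact h2.indicator hs

theorem measurable_weight (hσ : σ.IsBorel) (t₀ : ℝ) (n : ℕ) (loc : Fin (n + 1) → L)
    (act : Fin n → A) : Measurable (M.weight T σ t₀ n loc act) := by
  induction n with
  | zero => exact measurable_const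
  | succ n ih =>
    have hi : Measurable (Fin.init : (Fin (n + 1) → ℝ) → Fin n → ℝ) :=
      measurable_pi_lambda _ fun i => measurable_pi_apply _
    exact ((ih (Fin.init loc) (Fin.init act)).comp hi).mul
      ((M.measurable_stepDensity hσ t₀ ⟨n, Fin.init loc, Fin.init act⟩ (act (Fin.last n))
        (loc (Fin.last (n + 1)))).comp (hi.prodMk (measurable_pi_apply (Fin.last n))))

/-! ### Expectations at the time of the `n`-th transition -/

variable (T σ)

open scoped Classical in
/-- The expectation of `Φ`, evaluated at the history of the first `n` transitions, when these occur
up to the time bound. -/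
def stepSum (t₀ : ℝ) (n : ℕ) (l : L) (Φ : TimedPath L A → ℝ≥0∞) : ℝ≥0∞ :=
  ∑ loc : Fin (n + 1) → L, ∑ act : Fin n → A,
    if loc 0 = l then ∫⁻ τ, M.weight T σ t₀ n loc act τ * Φ ⟨⟨n, loc, act⟩, τ⟩ else 0

/-- The expectation of `Φ` after the next transition on the history `π`. -/
def nextStep (t₀ : ℝ) (Φ : TimedPath L A → ℝ≥0∞) (π : TimedPath L A) : ℝ≥0∞ :=
  ∑ a, ∑ l', ∫⁻ u, M.stepDensity T σ (π.lastEntry t₀) π a l' u * Φ (π.extend a l' u)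

variable {T σ}

theorem _root_.lintegral_fin_succ_eq_snoc {n : ℕ} {F : (Fin (n + 1) → ℝ) → ℝ≥0∞}
    (hF : Measurable F) :
    ∫⁻ τ, F τ = ∫⁻ τ : Fin n → ℝ, ∫⁻ u, F (Fin.snoc (α := fun _ => ℝ) τ u) := by
  have h := (volume_preserving_piFinSuccAbove (fun _ : Fin (n + 1) => ℝ) (Fin.last n)).symm
  rw [MeasurePreserving.lintegral_map_equiv F _ h, Measure.volume_eq_prod, lintegral_prod_symm]
  · simp only [MeasurableEquiv.piFinSuccAbove_symm_apply, Fin.insertNthEquiv, Equiv.coe_fn_mk,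
      Fin.insertNth_last']
  · exact (hF.comp (MeasurableEquiv.measurable _)).aemeasurable

theorem _root_.measurable_snoc {n : ℕ} :
    Measurable fun p : (Fin n → ℝ) × ℝ =>
      (Fin.snoc (α := fun _ => ℝ) p.1 p.2 : Fin (n + 1) → ℝ) := by
  refine measurable_pi_lambda _ fun i => ?_
  refine Fin.lastCases ?_ (fun j => ?_) i
  · simpa using measurable_snd
  · simp only [Fin.snoc_castSucc]
    fun_prop

theorem _root_.sum_fin_succ_eq_snoc {X β : Type*} [Fintype X] [AddCommMonoid β] {n : ℕ}
    (F : (Fin (n + 1) → X) → β) :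
    ∑ x, F x = ∑ x : Fin n → X, ∑ y, F (Fin.snoc (α := fun _ => X) x y) := by
  classical
  rw [Finset.sum_comm, ← Fintype.sum_prod_type']
  exact (Fintype.sum_equiv (Fin.snocEquiv fun _ => X) _ _ fun _ => rfl).symm

theorem measurable_nextStep_integrand (hσ : σ.IsBorel) (t₀ : ℝ) {Φ : TimedPath L A → ℝ≥0∞}
    (hΦ : ∀ s, Measurable fun τ => Φ ⟨s, τ⟩) (s : Skeleton L A) (a : A) (l' : L) :
    Measurable fun p : (Fin s.len → ℝ) × ℝ =>
      M.stepDensity T σ (TimedPath.lastEntry t₀ ⟨s, p.1⟩) ⟨s, p.1⟩ a l' p.2 *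
        Φ (TimedPath.extend ⟨s, p.1⟩ a l' p.2) :=
  (M.measurable_stepDensity hσ t₀ s a l').mul
    ((hΦ ⟨s.len + 1, Fin.snoc (α := fun _ => L) s.loc l',
      Fin.snoc (α := fun _ => A) s.act a⟩).comp measurable_snoc)

/-- By Fubini, the last transition can be integrated out first, conditionally on the history. -/
theorem stepSum_succ (hσ : σ.IsBorel) (t₀ : ℝ) (n : ℕ) (l : L) {Φ : TimedPath L A → ℝ≥0∞}
    (hΦ : ∀ s, Measurable fun τ => Φ ⟨s, τ⟩) :
    M.stepSum T σ t₀ (n + 1) l Φ = M.stepSum T σ t₀ n l (M.nextStep T σ t₀ Φ) := by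
  classical
  unfold stepSum
  rw [sum_fin_succ_eq_snoc]
  refine Finset.sum_congr rfl fun loc _ => ?_
  simp_rw [sum_fin_succ_eq_snoc (n := n) (X := A)]
  rw [Finset.sum_comm]
  refine Finset.sum_congr rfl fun act _ => ?_
  have h0 : ∀ l', (Fin.snoc (α := fun _ => L) loc l' : Fin (n + 2) → L) 0 = loc 0 := fun l' =>
    Fin.snoc_castSucc (α := fun _ => L) (i := 0) ..
  simp_rw [h0]
  split_ifs with hl
  · have hm := fun a l' => M.measurable_nextStep_integrand (T := T) hσ t₀ hΦ ⟨n, loc, act⟩ a l'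
    have hR : ∀ τ : Fin n → ℝ, M.weight T σ t₀ n loc act τ *
        M.nextStep T σ t₀ Φ ⟨⟨n, loc, act⟩, τ⟩ = ∑ l', ∑ a, M.weight T σ t₀ n loc act τ *
          ∫⁻ u, M.stepDensity T σ (TimedPath.lastEntry t₀ ⟨⟨n, loc, act⟩, τ⟩) ⟨⟨n, loc, act⟩, τ⟩
            a l' u * Φ (TimedPath.extend ⟨⟨n, loc, act⟩, τ⟩ a l' u) := by
      intro τ
      rw [nextStep, Finset.sum_comm, Finset.mul_sum]
      exact Finset.sum_congr rfl fun l' _ => Finset.mul_sum _ _ _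
    simp_rw [hR]
    have hmw := M.measurable_weight (T := T) hσ t₀ n loc act
    have hmr : ∀ a l', Measurable fun τ : Fin n → ℝ => M.weight T σ t₀ n loc act τ *
          ∫⁻ u, M.stepDensity T σ (TimedPath.lastEntry t₀ ⟨⟨n, loc, act⟩, τ⟩) ⟨⟨n, loc, act⟩, τ⟩
            a l' u * Φ (TimedPath.extend ⟨⟨n, loc, act⟩, τ⟩ a l' u) :=
      fun a l' => hmw.mul (hm a l').lintegral_prod_right'
    rw [lintegral_finsetSum _ fun l' _ => Finset.measurable_sum _ fun a _ => hmr a l']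
    refine Finset.sum_congr rfl fun l' _ => ?_
    rw [lintegral_finsetSum _ fun a _ => hmr a l']
    refine Finset.sum_congr rfl fun a _ => ?_
    have hw : Measurable fun τ => M.weight T σ t₀ (n + 1) (Fin.snoc (α := fun _ => L) loc l')
        (Fin.snoc (α := fun _ => A) act a) τ * Φ ⟨⟨n + 1, Fin.snoc (α := fun _ => L) loc l',
          Fin.snoc (α := fun _ => A) act a⟩, τ⟩ := (M.measurable_weight hσ t₀ _ _ _).mul
            (hΦ ⟨n + 1, Fin.snoc (α := fun _ => L) loc l', Fin.snoc (α := fun _ => A) act a⟩)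
    rw [lintegral_fin_succ_eq_snoc hw]
    refine lintegral_congr fun τ => ?_
    have hmu : Measurable fun u =>
        M.stepDensity T σ (TimedPath.lastEntry t₀ ⟨⟨n, loc, act⟩, τ⟩) ⟨⟨n, loc, act⟩, τ⟩ a l' u *
          Φ (TimedPath.extend ⟨⟨n, loc, act⟩, τ⟩ a l' u) :=
      (hm a l').comp (measurable_const.prodMk measurable_id)
    rw [← lintegral_const_mul _ hmu]
    refine lintegral_congr fun u => ?_
    rw [weight, Fin.init_snoc (α := fun _ => L), Fin.init_snoc (α := fun _ => A),
      Fin.init_snoc (α := fun _ => ℝ), Fin.snoc_last (α := fun _ => L),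
      Fin.snoc_last (α := fun _ => A), Fin.snoc_last (α := fun _ => ℝ), mul_assoc]
    rfl
  · simp

/-- The time-abstract part of a path as an element of a dependent sum over the number of
transitions. -/
def _root_.Skeleton.equivSigma :
    Skeleton L A ≃ Σ n : ℕ, (Fin (n + 1) → L) × (Fin n → A) where
  toFun s := ⟨s.len, s.loc, s.act⟩
  invFun p := ⟨p.1, p.2.1, p.2.2⟩
  left_inv _ := rfl
  right_inv _ := rfl

open scoped Classical in
/-- The conditional probability of ending in the goal region without a further transition. -/
def finish (T : ℝ) (σ : M.THRScheduler) (t₀ : ℝ) (π : TimedPath L A) : ℝ≥0∞ :=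
  if π.last ∈ M.goal then ENNReal.ofReal (M.survival σ π (π.lastEntry t₀) T) else 0

theorem measurable_finish (hσ : σ.IsBorel) (t₀ : ℝ) (s : Skeleton L A) :
    Measurable fun τ => M.finish T σ t₀ ⟨s, τ⟩ := by
  by_cases hg : s.loc (Fin.last _) ∈ M.goal
  · have h : (fun τ => M.finish T σ t₀ ⟨s, τ⟩) = fun τ => ENNReal.ofReal
        (M.survival σ ⟨s, τ⟩ (TimedPath.lastEntry t₀ ⟨s, τ⟩) T) := funext fun τ => if_pos hg
    rw [h]
    exact ((M.measurable_survival hσ s).comp (measurable_id.prodMk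
      ((TimedPath.measurable_lastEntry t₀ s).prodMk measurable_const))).ennreal_ofReal
  · have h : (fun τ => M.finish T σ t₀ ⟨s, τ⟩) = fun _ => 0 := funext fun τ => if_neg hg
    rw [h]
    exact measurable_const

/-- As the goal region is absorbing, it is visited if and only if the path ends there. -/
theorem reach_eq_tsum {t₀ : ℝ} (h₀ : t₀ ≤ T) (l : L) :
    M.reach T σ l t₀ = (∑' n, M.stepSum T σ t₀ n l (M.finish T σ t₀)).toReal := by
  classical
  have hmk : ∀ s : Skeleton L A,
      Measurable (Sigma.mk (β := fun s : Skeleton L A => Fin s.len → ℝ) s) :=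
    fun s _ h => MeasurableSpace.measurableSet_iInf.mp h s
  have hS : MeasurableSet {π : TimedPath L A | ∃ i, π.1.loc i ∈ M.goal} := by
    refine MeasurableSpace.measurableSet_iInf.mpr fun s => ?_
    change MeasurableSet {τ : Fin s.len → ℝ | ∃ i, s.loc i ∈ M.goal}
    exact MeasurableSet.const _
  have hs : ∀ s : Skeleton L A, (if s.loc 0 = l then
      (volume.withDensity fun τ : Fin s.len → ℝ =>
        ENNReal.ofReal (M.pathDensity T σ t₀ ⟨s, τ⟩)).map (Sigma.mk s) else 0)
        {π : TimedPath L A | ∃ i, π.1.loc i ∈ M.goal} =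
      if s.loc 0 = l then
        ∫⁻ τ, M.weight T σ t₀ s.len s.loc s.act τ * M.finish T σ t₀ ⟨s, τ⟩ else 0 := by
    rintro ⟨n, loc, act⟩
    split_ifs with hl
    · rw [Measure.map_apply (hmk _) hS]
      by_cases hg : ∃ i, loc i ∈ M.goal
      · have : Sigma.mk (β := fun s : Skeleton L A => Fin s.len → ℝ) ⟨n, loc, act⟩ ⁻¹'
            {π : TimedPath L A | ∃ i, π.1.loc i ∈ M.goal} = univ := eq_univ_of_forall fun _ => hg
        rw [this, withDensity_apply _ MeasurableSet.univ, Measure.restrict_univ]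
        refine lintegral_congr fun τ => ?_
        rw [M.ofReal_pathDensity T σ h₀, finish]
        split_ifs with hlast
        · rfl
        · rw [M.weight_eq_zero_of_leaves_goal T σ t₀ n loc act τ hg hlast, zero_mul, zero_mul]
      · have : Sigma.mk (β := fun s : Skeleton L A => Fin s.len → ℝ) ⟨n, loc, act⟩ ⁻¹'
            {π : TimedPath L A | ∃ i, π.1.loc i ∈ M.goal} = ∅ :=
          eq_empty_of_forall_notMem fun _ => hg
        rw [this, measure_empty]
        symm
        rw [lintegral_eq_zero_of_ae_eq_zero]
        refine Eventually.of_forall fun τ => ?_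
        have hlast : TimedPath.last (⟨⟨n, loc, act⟩, τ⟩ : TimedPath L A) ∉ M.goal :=
          fun h => hg ⟨_, h⟩
        simp [finish, hlast]
    · rfl
  rw [reach, Measure.real, pathLaw, Measure.sum_apply _ hS, tsum_congr hs,
    ← Skeleton.equivSigma.symm.tsum_eq, ENNReal.tsum_sigma']
  congr 2
  ext n
  rw [tsum_fintype, Fintype.sum_prod_type]
  rfl

end

end CTMDP

end

noncomputable section

namespace CTMDP

variable {L A : Type*} [Fintype L] [Fintype A] (M : CTMDP L A) {T : ℝ} {σ : M.THRScheduler}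

/-! ### Calculus of expectations -/

/-- Only histories whose last entry time lies between the starting time and the time bound have
positive weight. -/
theorem stepSum_mono {t₀ : ℝ} (h₀ : t₀ ≤ T) (n : ℕ) (l : L) {Φ Ψ : TimedPath L A → ℝ≥0∞}
    (h : ∀ π : TimedPath L A, π.lastEntry t₀ ∈ Icc t₀ T → Φ π ≤ Ψ π) :
    M.stepSum T σ t₀ n l Φ ≤ M.stepSum T σ t₀ n l Ψ := by
  classical
  refine Finset.sum_le_sum fun loc _ => Finset.sum_le_sum fun act _ => ?_
  split_ifs
  · refine lintegral_mono fun τ => ?_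
    simp only
    rw [M.weight_eq_prod T σ h₀]
    split_ifs with hv
    · gcongr
      exact h _ ⟨hv.1 (Fin.zero_le (Fin.last n)), hv.2 _⟩
    · simp
  · exact le_rfl

theorem stepSum_congr {t₀ : ℝ} (h₀ : t₀ ≤ T) (n : ℕ) (l : L) {Φ Ψ : TimedPath L A → ℝ≥0∞}
    (h : ∀ π : TimedPath L A, π.lastEntry t₀ ∈ Icc t₀ T → Φ π = Ψ π) :
    M.stepSum T σ t₀ n l Φ = M.stepSum T σ t₀ n l Ψ :=
  le_antisymm (M.stepSum_mono h₀ n l fun π hπ => (h π hπ).le)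
    (M.stepSum_mono h₀ n l fun π hπ => (h π hπ).ge)

theorem stepSum_add (hσ : σ.IsBorel) (t₀ : ℝ) (n : ℕ) (l : L) (Φ Ψ : TimedPath L A → ℝ≥0∞)
    (hΨ : ∀ s, Measurable fun τ => Ψ ⟨s, τ⟩) :
    M.stepSum T σ t₀ n l (fun π => Φ π + Ψ π) =
      M.stepSum T σ t₀ n l Φ + M.stepSum T σ t₀ n l Ψ := by
  classical
  unfold stepSum
  rw [← Finset.sum_add_distrib]
  refine Finset.sum_congr rfl fun loc _ => ?_
  rw [← Finset.sum_add_distrib]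
  refine Finset.sum_congr rfl fun act _ => ?_
  split_ifs
  · simp_rw [mul_add]
    exact lintegral_add_right _ ((M.measurable_weight hσ t₀ n loc act).mul (hΨ ⟨n, loc, act⟩))
  · simp

theorem stepSum_const_mul (t₀ : ℝ) (n : ℕ) (l : L) {c : ℝ≥0∞} (hc : c ≠ ∞)
    (Φ : TimedPath L A → ℝ≥0∞) :
    M.stepSum T σ t₀ n l (fun π => c * Φ π) = c * M.stepSum T σ t₀ n l Φ := by
  classical
  simp only [stepSum, Finset.mul_sum]
  refine Finset.sum_congr rfl fun loc _ => Finset.sum_congr rfl fun act _ => ?_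
  split_ifs
  · rw [← lintegral_const_mul' _ _ hc]
    simp_rw [mul_left_comm]
  · simp

/-- The expectation of `φ(l,t)`, where `l` is the last location and `t` the time of its entry. -/
def potential (t₀ : ℝ) (φ : L → ℝ → ℝ) (π : TimedPath L A) : ℝ≥0∞ :=
  ENNReal.ofReal (φ π.last (π.lastEntry t₀))

theorem stepSum_zero (t₀ : ℝ) (l : L) (φ : L → ℝ → ℝ) :
    M.stepSum T σ t₀ 0 l (potential t₀ φ) = ENNReal.ofReal (φ l t₀) := by
  classical
  unfold stepSum
  rw [Finset.sum_eq_single fun _ => l]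
  · rw [Fintype.sum_unique, if_pos rfl]
    have h : ∀ τ : Fin 0 → ℝ, potential t₀ φ (⟨⟨0, fun _ => l, default⟩, τ⟩ : TimedPath L A) =
        ENNReal.ofReal (φ l t₀) := fun τ => rfl
    simp only [weight, one_mul, h]
    rw [lintegral_const, volume_pi, Measure.pi_univ]
    simp
  · intro loc _ hne
    refine Finset.sum_eq_zero fun act _ => if_neg fun h => hne ?_
    funext i
    rw [Subsingleton.elim (α := Fin 1) i 0, h]
  · simp

theorem measurable_potential {L A : Type*} (t₀ : ℝ) {φ : L → ℝ → ℝ} (hφ : ∀ l, Measurable (φ l))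
    (s : Skeleton L A) : Measurable fun τ => potential t₀ φ ⟨s, τ⟩ :=
  ((hφ (s.loc (Fin.last _))).comp (TimedPath.measurable_lastEntry t₀ s)).ennreal_ofReal

theorem survival_eq_exp (π : TimedPath L A) (s t : ℝ) :
    M.survival σ π s t = Real.exp (-∫ u in s..t, M.exitRate σ π u) := rfl

theorem measurable_survival_right (hσ : σ.IsBorel) (π : TimedPath L A) (s : ℝ) :
    Measurable (M.survival σ π s) :=
  (M.measurable_survival hσ π.1).comp
    (measurable_const.prodMk (measurable_const.prodMk measurable_id))

theorem measurable_prob_right (hσ : σ.IsBorel) (π : TimedPath L A) (a : A) :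
    Measurable fun u => σ.prob π u a :=
  (hσ π.1 a).comp (measurable_const.prodMk measurable_id)

theorem nextStep_potential (hσ : σ.IsBorel) {t₀ : ℝ} (h₀ : 0 ≤ t₀) {φ : L → ℝ → ℝ}
    (hφ : ∀ l, Measurable (φ l)) (hφ0 : ∀ l, ∀ u ∈ Icc 0 T, 0 ≤ φ l u) {π : TimedPath L A}
    (hπ : π.lastEntry t₀ ∈ Icc t₀ T) :
    M.nextStep T σ t₀ (potential t₀ φ) π = ∫⁻ u in Icc (π.lastEntry t₀) T,
      ENNReal.ofReal (M.survival σ π (π.lastEntry t₀) u *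
        ∑ a, σ.prob π u a * ∑ l', M.rate π.last a l' * φ l' u) := by
  set s := π.lastEntry t₀ with hs
  have hm : ∀ a l', Measurable fun u => ENNReal.ofReal (M.survival σ π s u *
      (σ.prob π u a * M.rate π.last a l') * φ l' u) := fun a l' =>
    (((M.measurable_survival_right hσ π s).mul
      ((M.measurable_prob_right hσ π a).coe_nnreal_real.mul_const _)).mul (hφ l')).ennreal_ofReal
  have h1 : ∀ a l', ∫⁻ u, M.stepDensity T σ s π a l' u * potential t₀ φ (π.extend a l' u) =
      ∫⁻ u in Icc s T, ENNReal.ofReal (M.survival σ π s u *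
        (σ.prob π u a * M.rate π.last a l') * φ l' u) := by
    intro a l'
    rw [← lintegral_indicator measurableSet_Icc]
    refine lintegral_congr fun u => ?_
    simp only [potential, TimedPath.last_extend, TimedPath.lastEntry_extend, stepDensity]
    by_cases hu : u ∈ Icc s T
    · rw [indicator_of_mem hu, indicator_of_mem hu, ← ENNReal.ofReal_mul]
      exact mul_nonneg (M.survival_nonneg σ _ _ _) (by positivity)
    · rw [indicator_of_notMem hu, indicator_of_notMem hu, zero_mul]
  rw [nextStep]
  simp_rw [← hs, h1]
  have h2 : ∀ a, ∑ l', ∫⁻ u in Icc s T, ENNReal.ofReal (M.survival σ π s u *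
        (σ.prob π u a * M.rate π.last a l') * φ l' u) =
      ∫⁻ u in Icc s T, ∑ l', ENNReal.ofReal (M.survival σ π s u *
        (σ.prob π u a * M.rate π.last a l') * φ l' u) := fun a =>
    (lintegral_finsetSum _ fun l' _ => hm a l').symm
  simp_rw [h2]
  rw [← lintegral_finsetSum _ fun a _ => Finset.measurable_sum _ fun l' _ => hm a l']
  refine setLIntegral_congr_fun measurableSet_Icc fun u hu => ?_
  have hu0 : u ∈ Icc 0 T := ⟨h₀.trans (hπ.1.trans hu.1), hu.2⟩
  have hnn : ∀ a l', 0 ≤ M.survival σ π s u * (σ.prob π u a * M.rate π.last a l') * φ l' u :=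
    fun a l' => mul_nonneg (mul_nonneg (M.survival_nonneg σ _ _ _) (by positivity)) (hφ0 l' u hu0)
  simp_rw [← ENNReal.ofReal_sum_of_nonneg fun l' _ => hnn _ l']
  rw [← ENNReal.ofReal_sum_of_nonneg fun a _ => Finset.sum_nonneg fun l' _ => hnn a l']
  congr 1
  simp only [Finset.mul_sum]
  exact Finset.sum_congr rfl fun a _ => Finset.sum_congr rfl fun l' _ => by ring

/-! ### Potentials that bound the reachability probability -/

/-- `φ` is a family of bounded nonnegative functions with `-φ' = q` on `[0,T]` almost everywhere,
in integrated form. -/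
structure IsValueFunction (T : ℝ) (φ q : L → ℝ → ℝ) : Prop where
  measurable : ∀ l, Measurable (φ l)
  nonneg : ∀ l, ∀ u ∈ Icc 0 T, 0 ≤ φ l u
  bounded : ∃ C, ∀ l, ∀ u ∈ Icc 0 T, φ l u ≤ C
  integrable : ∀ l, IntervalIntegrable (q l) volume 0 T
  eq_integral : ∀ l, ∀ u ∈ Icc 0 T, φ l u = φ l T + ∫ v in u..T, q l v

/-- The expected gain on the history `π`. -/
def drift (σ : M.THRScheduler) (φ : L → ℝ → ℝ) (π : TimedPath L A) (u : ℝ) : ℝ :=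
  ∑ a, (σ.prob π u a : ℝ) * M.gain φ π.last a u

theorem sum_rate_eq_drift_add (φ : L → ℝ → ℝ) (π : TimedPath L A) (u : ℝ) :
    ∑ a, (σ.prob π u a : ℝ) * ∑ l', M.rate π.last a l' * φ l' u =
      M.drift σ φ π u + M.exitRate σ π u * φ π.last u := by
  simp only [drift, exitRate, gain, Finset.sum_mul, ← Finset.sum_add_distrib, coe_exit]
  refine Finset.sum_congr rfl fun a _ => ?_
  simp only [Finset.mul_sum, Finset.sum_mul, ← Finset.sum_add_distrib]
  exact Finset.sum_congr rfl fun l' _ => by ring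

section

variable {φ q : L → ℝ → ℝ} {t₀ : ℝ}

/-- The value of a potential splits into an integral over the time of the next transition, which
bounds (or equals) the expectation of the potential after it, and the contribution of no further
transition. The hypothesis `hd` makes the integrand nonnegative. -/
theorem lintegral_survival (hσ : σ.IsBorel) (hφ : IsValueFunction T φ q) (h₀ : 0 ≤ t₀)
    (hd : ∀ (π : TimedPath L A), ∀ u ∈ Icc 0 T, M.drift σ φ π u ≤ q π.last u)
    {π : TimedPath L A} (hπ : π.lastEntry t₀ ∈ Icc t₀ T) :
    (∫⁻ u in Icc (π.lastEntry t₀) T, ENNReal.ofReal (M.survival σ π (π.lastEntry t₀) u *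
        (q π.last u + M.exitRate σ π u * φ π.last u))) +
      ENNReal.ofReal (M.survival σ π (π.lastEntry t₀) T * φ π.last T) =
    potential t₀ φ π := by
  rw [potential]
  set s := π.lastEntry t₀ with hs
  set l := π.last
  have hs0 : 0 ≤ s := h₀.trans hπ.1
  have hsT : s ≤ T := hπ.2
  have hsub : Icc s T ⊆ Icc 0 T := Icc_subset_Icc hs0 le_rfl
  have hqs : IntervalIntegrable (q l) volume s T := (hφ.integrable l).mono_set (by
    rw [uIcc_of_le hsT, uIcc_of_le (hs0.trans hsT)]; exact hsub)
  obtain ⟨C, hC⟩ := hφ.bounded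
  have hint := integral_survival_mul (E := M.exitRate σ π) (q := q l) (f := φ l) (c := φ l T)
    hsT (M.measurable_exitRate_right hσ π) (fun u _ => M.exitRate_nonneg π u)
    (fun u _ => M.exitRate_le π u) hqs fun u hu => hφ.eq_integral l u (hsub hu)
  simp only [← survival_eq_exp] at hint
  have hnn : ∀ u ∈ Icc s T,
      0 ≤ M.survival σ π s u * (q l u + M.exitRate σ π u * φ l u) := by
    intro u hu
    refine mul_nonneg (M.survival_nonneg σ _ _ _) ?_
    have h1 := hd π u (hsub hu)
    have h2 := M.sum_rate_eq_drift_add (σ := σ) φ π u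
    have h3 : 0 ≤ ∑ a, (σ.prob π u a : ℝ) * ∑ l', M.rate π.last a l' * φ l' u :=
      Finset.sum_nonneg fun a _ => mul_nonneg (NNReal.coe_nonneg _) (Finset.sum_nonneg
        fun l' _ => mul_nonneg (NNReal.coe_nonneg _) (hφ.nonneg l' u (hsub hu)))
    change 0 ≤ q π.last u + M.exitRate σ π u * φ π.last u
    linarith
  have hIq : IntegrableOn (q l) (Ioc s T) :=
    (intervalIntegrable_iff_integrableOn_Ioc_of_le hsT).mp hqs
  have hIE : IntegrableOn (fun u => M.exitRate σ π u * φ l u) (Ioc s T) := by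
    refine Measure.integrableOn_of_bounded (M := M.rateBound * C) (by simp)
      ((M.measurable_exitRate_right hσ π).mul (hφ.measurable l)).aestronglyMeasurable ?_
    filter_upwards [ae_restrict_mem measurableSet_Ioc] with u hu
    have hu' := hsub ⟨hu.1.le, hu.2⟩
    rw [Real.norm_eq_abs, abs_of_nonneg
      (mul_nonneg (M.exitRate_nonneg π u) (hφ.nonneg l u hu'))]
    exact mul_le_mul (M.exitRate_le π u) (hC l u hu') (hφ.nonneg l u hu') M.rateBound_nonneg
  have hI : IntegrableOn (fun u => M.survival σ π s u * (q l u + M.exitRate σ π u * φ l u))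
      (Ioc s T) := by
    refine (hIq.add hIE).bdd_mul (c := 1)
      (M.measurable_survival_right hσ π s).aestronglyMeasurable ?_
    filter_upwards [ae_restrict_mem measurableSet_Ioc] with u hu
    rw [Real.norm_eq_abs, abs_of_nonneg (M.survival_nonneg σ _ _ _)]
    exact M.survival_le_one π hu.1.le
  rw [← restrict_Ioc_eq_restrict_Icc, ← ofReal_integral_eq_lintegral_ofReal hI,
    ← intervalIntegral.integral_of_le hsT, hint, ← ENNReal.ofReal_add]
  · congr 1
    ring
  · rw [← hint]
    exact intervalIntegral.integral_nonneg hsT hnn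
  · exact mul_nonneg (M.survival_nonneg σ _ _ _) (hφ.nonneg l T ⟨hs0.trans hsT, le_rfl⟩)
  · filter_upwards [ae_restrict_mem measurableSet_Ioc] with u hu
    exact hnn u ⟨hu.1.le, hu.2⟩

theorem nextStep_add_finish_le (hσ : σ.IsBorel) (hφ : IsValueFunction T φ q) (h₀ : 0 ≤ t₀)
    (hd : ∀ (π : TimedPath L A), ∀ u ∈ Icc 0 T, M.drift σ φ π u ≤ q π.last u)
    (hg : ∀ l ∈ M.goal, 1 ≤ φ l T) {π : TimedPath L A} (hπ : π.lastEntry t₀ ∈ Icc t₀ T) :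
    M.nextStep T σ t₀ (potential t₀ φ) π + M.finish T σ t₀ π ≤ potential t₀ φ π := by
  rw [← M.lintegral_survival hσ hφ h₀ hd hπ,
    M.nextStep_potential hσ h₀ hφ.measurable hφ.nonneg hπ]
  refine add_le_add (setLIntegral_mono' measurableSet_Icc fun u hu => ?_) ?_
  · rw [M.sum_rate_eq_drift_add]
    refine ENNReal.ofReal_le_ofReal (mul_le_mul_of_nonneg_left ?_ (M.survival_nonneg σ _ _ _))
    linarith [hd π u ⟨h₀.trans (hπ.1.trans hu.1), hu.2⟩]
  · rw [finish]
    split_ifs with h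
    · exact ENNReal.ofReal_le_ofReal
        (le_mul_of_one_le_right (M.survival_nonneg σ _ _ _) (hg _ h))
    · exact zero_le

theorem nextStep_add_finish_eq (hσ : σ.IsBorel) (hφ : IsValueFunction T φ q) (h₀ : 0 ≤ t₀)
    (hd : ∀ (π : TimedPath L A), ∀ u ∈ Icc 0 T, M.drift σ φ π u = q π.last u)
    (hg : ∀ l ∈ M.goal, φ l T = 1) (hg' : ∀ l ∉ M.goal, φ l T = 0) {π : TimedPath L A}
    (hπ : π.lastEntry t₀ ∈ Icc t₀ T) :
    M.nextStep T σ t₀ (potential t₀ φ) π + M.finish T σ t₀ π = potential t₀ φ π := by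
  rw [← M.lintegral_survival hσ hφ h₀ (fun π u hu => (hd π u hu).le) hπ,
    M.nextStep_potential hσ h₀ hφ.measurable hφ.nonneg hπ]
  congr 1
  · refine setLIntegral_congr_fun measurableSet_Icc fun u hu => ?_
    rw [M.sum_rate_eq_drift_add, hd π u ⟨h₀.trans (hπ.1.trans hu.1), hu.2⟩]
  · rw [finish]
    split_ifs with h
    · rw [hg _ h, mul_one]
    · rw [hg' _ h, mul_zero, ENNReal.ofReal_zero]

/-- A potential whose expected gain never exceeds its rate of decrease is a supermartingale. If it
is at least the indicator of the goal region at the time bound, it bounds the reachability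
probability. -/
theorem reach_le (hσ : σ.IsBorel) (hφ : IsValueFunction T φ q)
    (hd : ∀ (π : TimedPath L A), ∀ u ∈ Icc 0 T, M.drift σ φ π u ≤ q π.last u)
    (hg : ∀ l ∈ M.goal, 1 ≤ φ l T) (l : L) (ht : t₀ ∈ Icc 0 T) : M.reach T σ l t₀ ≤ φ l t₀ := by
  have key : ∀ n, (∑ k ∈ Finset.range n, M.stepSum T σ t₀ k l (M.finish T σ t₀)) +
      M.stepSum T σ t₀ n l (potential t₀ φ) ≤ ENNReal.ofReal (φ l t₀) := by
    intro n
    induction n with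
    | zero => simp [M.stepSum_zero]
    | succ n ih =>
      refine le_trans ?_ ih
      rw [Finset.sum_range_succ, add_assoc]
      refine add_le_add le_rfl ?_
      rw [M.stepSum_succ hσ t₀ n l (measurable_potential t₀ hφ.measurable), add_comm,
        ← M.stepSum_add hσ t₀ n l _ _ (M.measurable_finish hσ t₀)]
      exact M.stepSum_mono ht.2 n l fun π hπ => M.nextStep_add_finish_le hσ hφ ht.1 hd hg hπ
  rw [M.reach_eq_tsum ht.2]
  refine ENNReal.toReal_le_of_le_ofReal (hφ.nonneg l t₀ ht) (ENNReal.tsum_le_of_sum_range_le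
    fun n => le_self_add.trans (key n))

/-- The expectation of an exponentially weighted potential at least halves with every transition:
this excludes explosion. -/
theorem nextStep_exp_le (hσ : σ.IsBorel) (h₀ : 0 ≤ t₀) {C : ℝ} (hC : 0 ≤ C) {π : TimedPath L A}
    (hπ : π.lastEntry t₀ ∈ Icc t₀ T) :
    M.nextStep T σ t₀
        (potential t₀ fun _ u => C * Real.exp (2 * (M.rateBound + 1) * (T - u))) π ≤
      2⁻¹ * potential t₀ (fun _ u => C * Real.exp (2 * (M.rateBound + 1) * (T - u))) π := by
  have hc : 0 < M.rateBound + 1 := by linarith [M.rateBound_nonneg]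
  rw [M.nextStep_potential hσ h₀ (fun _ => by fun_prop) (fun _ _ _ => by positivity) hπ]
  set c := M.rateBound + 1 with hcdef
  set s := π.lastEntry t₀ with hs
  calc _ ≤ ∫⁻ u in Icc s T, ENNReal.ofReal (c * (C * Real.exp (2 * c * (T - u)))) := by
        refine setLIntegral_mono' measurableSet_Icc fun u hu => ENNReal.ofReal_le_ofReal ?_
        have h1 : ∑ a, (σ.prob π u a : ℝ) * ∑ l', M.rate π.last a l' *
            (C * Real.exp (2 * c * (T - u))) =
            M.exitRate σ π u * (C * Real.exp (2 * c * (T - u))) := by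
          simp only [← Finset.sum_mul, ← mul_assoc, ← M.coe_exit]
          rfl
        rw [h1]
        have h2 : M.exitRate σ π u ≤ c := by linarith [M.exitRate_le (σ := σ) π u]
        have h3 := M.survival_le_one (σ := σ) π hu.1
        have h4 := M.exitRate_nonneg (σ := σ) π u
        calc _ ≤ 1 * (M.exitRate σ π u * (C * Real.exp (2 * c * (T - u)))) :=
              mul_le_mul_of_nonneg_right h3 (by positivity)
          _ ≤ c * (C * Real.exp (2 * c * (T - u))) := by
              rw [one_mul]
              exact mul_le_mul_of_nonneg_right h2 (by positivity)
    _ = ENNReal.ofReal (∫ u in s..T, c * (C * Real.exp (2 * c * (T - u)))) := by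
        rw [intervalIntegral.integral_of_le hπ.2, ofReal_integral_eq_lintegral_ofReal,
          restrict_Ioc_eq_restrict_Icc]
        · exact (Continuous.integrableOn_Icc (by fun_prop)).mono_set Ioc_subset_Icc_self
        · exact Eventually.of_forall fun u => by positivity
    _ ≤ ENNReal.ofReal (2⁻¹ * (C * Real.exp (2 * c * (T - s)))) := by
        refine ENNReal.ofReal_le_ofReal ?_
        have hder : ∀ u ∈ uIcc s T, HasDerivAt
            (fun u => -(2⁻¹ * (C * Real.exp (2 * c * (T - u)))))
            (c * (C * Real.exp (2 * c * (T - u)))) u := by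
          intro u _
          have h1 : HasDerivAt (fun u => 2 * c * (T - u)) (2 * c * (-1)) u := by
            simpa using ((hasDerivAt_id u).const_sub T).const_mul (2 * c)
          have h2 := ((h1.exp.const_mul C).const_mul 2⁻¹).neg
          refine h2.congr_deriv ?_
          ring
        rw [intervalIntegral.integral_eq_sub_of_hasDerivAt hder
          (Continuous.intervalIntegrable (by fun_prop) _ _)]
        simp
        positivity
    _ = _ := by
        rw [ENNReal.ofReal_mul (by norm_num), ENNReal.ofReal_inv_of_pos (by norm_num)]
        simp [potential, hs]

theorem tendsto_stepSum_potential (hσ : σ.IsBorel) (hφ : IsValueFunction T φ q) (l : L)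
    (ht : t₀ ∈ Icc 0 T) :
    Tendsto (fun n => M.stepSum T σ t₀ n l (potential t₀ φ)) atTop (𝓝 0) := by
  obtain ⟨C, hC⟩ := hφ.bounded
  have hC0 : 0 ≤ C := (hφ.nonneg l t₀ ht).trans (hC l t₀ ht)
  set ψ : L → ℝ → ℝ := fun _ u => C * Real.exp (2 * (M.rateBound + 1) * (T - u)) with hψ
  have hc : 0 < M.rateBound + 1 := by linarith [M.rateBound_nonneg]
  have key : ∀ n, M.stepSum T σ t₀ n l (potential t₀ ψ) ≤
      2⁻¹ ^ n * ENNReal.ofReal (ψ l t₀) := by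
    intro n
    induction n with
    | zero => simp [M.stepSum_zero]
    | succ n ih =>
      rw [M.stepSum_succ hσ t₀ n l (measurable_potential t₀ fun _ => by fun_prop), pow_succ',
        mul_assoc]
      refine (M.stepSum_mono ht.2 n l fun π hπ => M.nextStep_exp_le hσ ht.1 hC0 hπ).trans ?_
      rw [M.stepSum_const_mul t₀ n l (by simp)]
      gcongr
  have h2 : Tendsto (fun n : ℕ => (2⁻¹ : ℝ≥0∞) ^ n * ENNReal.ofReal (ψ l t₀)) atTop (𝓝 0) := by
    have := ENNReal.Tendsto.mul_const (b := ENNReal.ofReal (ψ l t₀))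
      (ENNReal.tendsto_pow_atTop_nhds_zero_of_lt_one (r := 2⁻¹) (by simp)) (Or.inr (by simp))
    simpa using this
  refine tendsto_of_tendsto_of_tendsto_of_le_of_le tendsto_const_nhds h2 (fun _ => zero_le)
    fun n => le_trans (M.stepSum_mono ht.2 n l fun π hπ => ?_) (key n)
  refine ENNReal.ofReal_le_ofReal ((hC _ _ ⟨ht.1.trans hπ.1, hπ.2⟩).trans ?_)
  refine le_mul_of_one_le_right hC0 (Real.one_le_exp ?_)
  have := hπ.2
  exact mul_nonneg (by positivity) (by linarith)

/-- If the expected gain of a potential always equals its rate of decrease, then it is a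
martingale. If it is the indicator of the goal region at the time bound, it is the reachability
probability. -/
theorem reach_eq (hσ : σ.IsBorel) (hφ : IsValueFunction T φ q)
    (hd : ∀ (π : TimedPath L A), ∀ u ∈ Icc 0 T, M.drift σ φ π u = q π.last u)
    (hg : ∀ l ∈ M.goal, φ l T = 1) (hg' : ∀ l ∉ M.goal, φ l T = 0) (l : L)
    (ht : t₀ ∈ Icc 0 T) : M.reach T σ l t₀ = φ l t₀ := by
  have key : ∀ n, (∑ k ∈ Finset.range n, M.stepSum T σ t₀ k l (M.finish T σ t₀)) +
      M.stepSum T σ t₀ n l (potential t₀ φ) = ENNReal.ofReal (φ l t₀) := by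
    intro n
    induction n with
    | zero => simp [M.stepSum_zero]
    | succ n ih =>
      rw [← ih, Finset.sum_range_succ, add_assoc]
      congr 1
      rw [M.stepSum_succ hσ t₀ n l (measurable_potential t₀ hφ.measurable), add_comm,
        ← M.stepSum_add hσ t₀ n l _ _ (M.measurable_finish hσ t₀)]
      exact M.stepSum_congr ht.2 n l
        fun π hπ => M.nextStep_add_finish_eq hσ hφ ht.1 hd hg hg' hπ
  have hlim := (ENNReal.tendsto_nat_tsum fun k => M.stepSum T σ t₀ k l (M.finish T σ t₀)).add
    (M.tendsto_stepSum_potential hσ hφ l ht)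
  simp only [key, add_zero] at hlim
  rw [M.reach_eq_tsum ht.2, ← tendsto_nhds_unique tendsto_const_nhds hlim,
    ENNReal.toReal_ofReal (hφ.nonneg l t₀ ht)]

end

end CTMDP

end

noncomputable section

namespace CTMDP

variable {L A : Type*} [Fintype L] [Fintype A] {M : CTMDP L A} {T : ℝ}

/-! ### The distance of timed positional deterministic schedulers -/

/-- A timed positional deterministic scheduler that is a Borel function of time. -/
def TPDScheduler.IsBorel (S : M.TPDScheduler) : Prop :=
  ∀ l a, MeasurableSet {t | S.choice l t = a}

theorem TPDScheduler.IsBorel.measurable_comp {D E : M.TPDScheduler} (hD : D.IsBorel)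
    (hE : E.IsBorel) {β : Type*} [MeasurableSpace β] (F : A → A → β) (l : L) :
    Measurable fun t => F (D.choice l t) (E.choice l t) := by
  let : MeasurableSpace A := ⊤
  have h : ∀ {S : M.TPDScheduler}, S.IsBorel → Measurable (S.choice l) := fun hS =>
    measurable_to_countable' fun a => hS l a
  exact (Measurable.of_discrete (f := fun c : A × A => F c.1 c.2)).comp ((h hD).prodMk (h hE))

theorem TPDScheduler.IsBorel.toTHR {S : M.TPDScheduler} (hS : S.IsBorel) : S.toTHR.IsBorel := by
  classical
  intro s a
  exact (hS.measurable_comp hS (fun b _ => if a = b then (1 : ℝ≥0) else 0)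
    (s.loc (Fin.last _))).comp measurable_snd

/-- The points in time at which two schedulers take different decisions in some location. -/
def disagree (D E : M.TPDScheduler) : Set ℝ := {t | ∃ l, D.choice l t ≠ E.choice l t}

theorem measurableSet_disagree {D E : M.TPDScheduler} (hD : D.IsBorel) (hE : E.IsBorel) :
    MeasurableSet (disagree D E) := by
  rw [disagree, Set.ofPred_exists]
  exact MeasurableSet.iUnion fun l =>
    measurableSet_setOfPred.mpr (hD.measurable_comp hE (fun a b => a ≠ b) l)

open scoped Classical in
theorem diffScheduler_prob_some (D E : M.TPDScheduler) {π : TimedPath (Option L) (DiffAct A)}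
    {l : L} (hπ : π.last = some l) (t : ℝ) :
    (diffScheduler D.toTHR E.toTHR).prob π t =
      M.diffDecision l (fun a => if a = D.choice l t then 1 else 0)
        (fun a => if a = E.choice l t then 1 else 0) := by
  have hl : (projPath l (M.someEnabled l) π).last = l := by
    have h1 : π.1.loc (Fin.last π.1.len) = some l := hπ
    simp [TimedPath.last, projPath, h1]
  change diffProb D.toTHR E.toTHR π t = _
  rw [diffProb, hπ]
  simp only [Option.elim, TPDScheduler.toTHR, hl]

theorem isBorel_diffScheduler {D E : M.TPDScheduler} (hD : D.IsBorel) (hE : E.IsBorel) :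
    (diffScheduler D.toTHR E.toTHR).IsBorel := by
  classical
  intro s x
  rcases hs : s.loc (Fin.last _) with _ | l
  · have h : (fun p : (Fin s.len → ℝ) × ℝ =>
        (diffScheduler D.toTHR E.toTHR).prob ⟨s, p.1⟩ p.2 x) =
        fun _ => if x = Sum.inr (Sum.inr ()) then 1 else 0 := by
      funext p
      change diffProb D.toTHR E.toTHR ⟨s, p.1⟩ p.2 x = _
      have hlast : TimedPath.last (⟨s, p.1⟩ : TimedPath (Option L) (DiffAct A)) = none := hs
      rw [diffProb, hlast]
      rfl
    rw [h]
    exact measurable_const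
  · have h : (fun p : (Fin s.len → ℝ) × ℝ =>
        (diffScheduler D.toTHR E.toTHR).prob ⟨s, p.1⟩ p.2 x) =
        fun p => M.diffDecision l (fun a => if a = D.choice l p.2 then 1 else 0)
          (fun a => if a = E.choice l p.2 then 1 else 0) x := by
      funext p
      rw [diffScheduler_prob_some D E (π := ⟨s, p.1⟩) hs]
    rw [h]
    exact (hD.measurable_comp hE (fun b c => M.diffDecision l (fun a => if a = b then 1 else 0)
          (fun a => if a = c then 1 else 0) x) l).comp measurable_snd

/-- The potential for the difference scheduler: the fresh goal location is entered at most with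
rate `2 * rateBound`, and only at times in `N`. -/
def diffPotential (M : CTMDP L A) (T : ℝ) (N : Set ℝ) : Option L → ℝ → ℝ
  | none, _ => 1
  | some _, u => ∫ v in u..T, N.indicator (fun _ => 2 * M.rateBound) v

/-- The rate of decrease of `diffPotential`. -/
def diffPotentialRate (M : CTMDP L A) (N : Set ℝ) : Option L → ℝ → ℝ
  | none, _ => 0
  | some _, v => N.indicator (fun _ => 2 * M.rateBound) v

theorem intervalIntegrable_indicator_const {N : Set ℝ} (hN : MeasurableSet N) (c a b : ℝ) :
    IntervalIntegrable (N.indicator fun _ => c) volume a b :=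
  intervalIntegrable_iff.mpr
    ((integrableOn_const (by simp) (by simp)).indicator hN)

theorem isValueFunction_diffPotential {N : Set ℝ} (hN : MeasurableSet N) :
    IsValueFunction T (M.diffPotential T N) (M.diffPotentialRate N) where
  measurable o := by
    cases o with
    | none => exact measurable_const
    | some l =>
      have h := (intervalIntegral.continuous_primitive
        (fun a b => intervalIntegrable_indicator_const hN (2 * M.rateBound) a b) T).neg
      have heq : M.diffPotential T N (some l) =
          -fun u => ∫ v in T..u, N.indicator (fun _ => 2 * M.rateBound) v :=
        funext fun u => intervalIntegral.integral_symm T u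
      rw [heq]
      exact h.measurable
  nonneg o u hu := by
    cases o with
    | none => exact zero_le_one
    | some l =>
      exact intervalIntegral.integral_nonneg hu.2 fun v _ =>
        indicator_nonneg (fun _ _ => mul_nonneg zero_le_two M.rateBound_nonneg) v
  bounded := by
    have hC := M.rateBound_nonneg
    refine ⟨1 + 2 * M.rateBound * T, fun o u hu => ?_⟩
    have hT : 0 ≤ T := hu.1.trans hu.2
    cases o with
    | none => simp only [diffPotential]; nlinarith [mul_nonneg hC hT]
    | some l =>
      have h : ∫ v in u..T, N.indicator (fun _ => 2 * M.rateBound) v ≤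
          ∫ _ in u..T, 2 * M.rateBound :=
        intervalIntegral.integral_mono_on hu.2 (intervalIntegrable_indicator_const hN _ _ _)
          intervalIntegrable_const fun v _ => indicator_le_self' (fun _ _ => by positivity) v
      rw [intervalIntegral.integral_const, smul_eq_mul] at h
      simp only [diffPotential]
      nlinarith [mul_nonneg hC hu.1]
  integrable o := by
    cases o with
    | none => exact intervalIntegrable_const
    | some l => exact intervalIntegrable_indicator_const hN _ _ _
  eq_integral o u _ := by
    cases o with
    | none => simp [diffPotential, diffPotentialRate]
    | some l => simp [diffPotential, diffPotentialRate]

theorem gain_diffModel_none (φ : Option L → ℝ → ℝ) (x : DiffAct A) (u : ℝ) :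
    M.diffModel.gain φ none x u = 0 := by
  rw [gain, Fintype.sum_option]
  simp [diffModel, diffRate]

theorem gain_diffModel_old {φ : Option L → ℝ → ℝ} {u : ℝ}
    (hφ : ∀ l l', φ (some l) u = φ (some l') u) (l : L) (a : A) :
    M.diffModel.gain φ (some l) (Sum.inl a) u = 0 := by
  rw [gain, Fintype.sum_option]
  simp [diffModel, diffRate, hφ _ l]

theorem gain_diffModel_fresh (φ : Option L → ℝ → ℝ) (u : ℝ) (l : L) (a b : A) :
    M.diffModel.gain φ (some l) (Sum.inr (Sum.inl (a, b))) u =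
      (M.exit l a + M.exit l b) * (φ none u - φ (some l) u) := by
  rw [gain, Fintype.sum_option]
  simp [diffModel, diffRate]

theorem gain_diffModel_unit (φ : Option L → ℝ → ℝ) (u : ℝ) (l : L) :
    M.diffModel.gain φ (some l) (Sum.inr (Sum.inr ())) u = 0 := by
  rw [gain, Fintype.sum_option]
  simp [diffModel, diffRate]

theorem drift_diffPotential_le {D E : M.TPDScheduler} (hD : D.IsBorel) (hE : E.IsBorel)
    (π : TimedPath (Option L) (DiffAct A)) {u : ℝ} (hu : u ∈ Icc 0 T) :
    M.diffModel.drift (diffScheduler D.toTHR E.toTHR) (M.diffPotential T (disagree D E)) π u ≤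
      M.diffPotentialRate (disagree D E) π.last u := by
  classical
  have hC := M.rateBound_nonneg
  rcases hπ : π.last with _ | l
  · simp only [drift, hπ, gain_diffModel_none, mul_zero, Finset.sum_const_zero]
    exact le_rfl
  have hold : ∀ l l', M.diffPotential T (disagree D E) (some l) u =
    M.diffPotential T (disagree D E) (some l') u := fun _ _ => rfl
  rw [drift, hπ]
  by_cases hN : u ∈ disagree D E
  · have hq : M.diffPotentialRate (disagree D E) (some l) u = 2 * M.rateBound :=
      indicator_of_mem (f := fun _ => 2 * M.rateBound) hN
    rw [hq]
    have hgain : ∀ x, M.diffModel.gain (M.diffPotential T (disagree D E)) (some l) x u ≤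
        2 * M.rateBound := by
      rintro (a | ⟨a, b⟩ | ⟨⟩)
      · rw [gain_diffModel_old hold]
        positivity
      · rw [gain_diffModel_fresh]
        have h1 : 0 ≤ M.diffPotential T (disagree D E) (some l) u :=
          (isValueFunction_diffPotential (M := M) (measurableSet_disagree hD hE)).nonneg _ u hu
        have h2 : M.diffPotential T (disagree D E) none u = 1 := rfl
        have h3 := M.exit_le_rateBound l a
        have h4 := M.exit_le_rateBound l b
        have h5 : (0 : ℝ) ≤ M.exit l a + M.exit l b := by positivity
        rw [h2]
        nlinarith [mul_nonneg h5 h1]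
      · rw [gain_diffModel_unit]
        positivity
    calc _ ≤ ∑ x, ((diffScheduler D.toTHR E.toTHR).prob π u x : ℝ) * (2 * M.rateBound) :=
          Finset.sum_le_sum fun x _ => mul_le_mul_of_nonneg_left (hgain x) (NNReal.coe_nonneg _)
      _ = 2 * M.rateBound := by rw [← Finset.sum_mul, M.diffModel.sum_coe_prob, one_mul]
  · have hq : M.diffPotentialRate (disagree D E) (some l) u = 0 :=
      indicator_of_notMem (f := fun _ => 2 * M.rateBound) hN
    rw [hq]
    have hDE : D.choice l u = E.choice l u := by
      by_contra h
      exact hN ⟨l, h⟩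
    refine (Finset.sum_eq_zero fun x _ => ?_).le
    rcases x with a | ⟨a, b⟩ | ⟨⟩
    · rw [gain_diffModel_old hold, mul_zero]
    · have h : (diffScheduler D.toTHR E.toTHR).prob π u (Sum.inr (Sum.inl (a, b))) = 0 := by
        rw [diffScheduler_prob_some D E hπ, hDE]
        simp [diffDecision]
      rw [h, NNReal.coe_zero, zero_mul]
    · rw [gain_diffModel_unit, mul_zero]

theorem schedDist_nonneg (D E : M.THRScheduler) : 0 ≤ schedDist T D E :=
  Finset.sum_nonneg fun _ _ => mul_nonneg (NNReal.coe_nonneg _) measureReal_nonneg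

/-- The distance of two timed positional schedulers is controlled by the amount of time at which
they differ. -/
theorem schedDist_le (hT : 0 ≤ T) {D E : M.TPDScheduler} (hD : D.IsBorel) (hE : E.IsBorel) :
    schedDist T D.toTHR E.toTHR ≤
      2 * M.rateBound * (volume.restrict (Icc 0 T)).real (disagree D E) := by
  have hN := measurableSet_disagree hD hE
  have h0 : (0 : ℝ) ∈ Icc 0 T := ⟨le_rfl, hT⟩
  have hle : ∀ o, M.diffModel.reach T (diffScheduler D.toTHR E.toTHR) o 0 ≤
      M.diffPotential T (disagree D E) o 0 := fun o =>
    M.diffModel.reach_le (isBorel_diffScheduler hD hE) (isValueFunction_diffPotential hN)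
      (fun π u hu => drift_diffPotential_le hD hE π hu)
      (fun o ho => by obtain rfl : o = none := ho; exact le_rfl) o h0
  have hint : ∫ v in (0 : ℝ)..T, (disagree D E).indicator (fun _ => 2 * M.rateBound) v =
      2 * M.rateBound * (volume.restrict (Icc 0 T)).real (disagree D E) := by
    rw [intervalIntegral.integral_of_le hT, restrict_Ioc_eq_restrict_Icc,
      integral_indicator_const _ hN, smul_eq_mul, mul_comm]
  have hsum : ∑ l, (M.init l : ℝ) = 1 := by exact_mod_cast M.init_sum
  calc schedDist T D.toTHR E.toTHR
      ≤ ∑ o, (M.diffModel.init o : ℝ) * M.diffPotential T (disagree D E) o 0 :=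
        Finset.sum_le_sum fun o _ => mul_le_mul_of_nonneg_left (hle o) (NNReal.coe_nonneg _)
    _ = ∑ l, (M.init l : ℝ) *
          (2 * M.rateBound * (volume.restrict (Icc 0 T)).real (disagree D E)) := by
        rw [Fintype.sum_option]
        simp only [diffModel, diffPotential, hint]
        simp
    _ = _ := by rw [← Finset.sum_mul, hsum, one_mul]

/-! ### Approximation by cylindrical schedulers -/

/-- The Borel sets that are unions of cells of a finite partition of the line. -/
def cellAlgebra : Set (Set ℝ) :=
  {C | MeasurableSet C ∧ ∃ J : Finset ℝ, ∀ t t', SameCell J t t' → (t ∈ C ↔ t' ∈ C)}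

theorem isSetAlgebra_cellAlgebra : IsSetAlgebra cellAlgebra where
  empty_mem := ⟨MeasurableSet.empty, ∅, fun _ _ _ => Iff.rfl⟩
  compl_mem := fun _ ⟨hm, J, hJ⟩ => ⟨hm.compl, J, fun t t' h => not_congr (hJ t t' h)⟩
  union_mem := fun _ _ ⟨hm, J, hJ⟩ ⟨hm', J', hJ'⟩ => by
    classical
    exact ⟨hm.union hm', J ∪ J', fun t t' h => or_congr
      (hJ t t' fun b hb => h b (Finset.mem_union_left _ hb))
      (hJ' t t' fun b hb => h b (Finset.mem_union_right _ hb))⟩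

theorem generateFrom_cellAlgebra :
    Real.measurableSpace = MeasurableSpace.generateFrom cellAlgebra := by
  refine le_antisymm ?_ (MeasurableSpace.generateFrom_le fun C hC => hC.1)
  have h : Real.measurableSpace = MeasurableSpace.generateFrom (range Iic) :=
    (BorelSpace.measurable_eq (α := ℝ)).trans (borel_eq_generateFrom_Iic ℝ)
  rw [h]
  refine MeasurableSpace.generateFrom_mono ?_
  rintro _ ⟨b, rfl⟩
  exact ⟨measurableSet_Iic, {b}, fun t t' h => h b (Finset.mem_singleton_self b)⟩

/-- Clamping to `[0,T]` preserves cells, if the endpoints outside of `[0,T]` are dropped. -/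
theorem SameCell.projIcc (hT : 0 ≤ T) {J : Finset ℝ} {t t' : ℝ}
    (h : SameCell (insert T (J.filter fun b => 0 ≤ b ∧ b ≤ T)) t t') :
    SameCell J (Set.projIcc 0 T hT t) (Set.projIcc 0 T hT t') := by
  intro b hb
  simp only [coe_projIcc, max_le_iff, min_le_iff]
  by_cases hb0 : 0 ≤ b
  · by_cases hbT : b < T
    · have := h b (Finset.mem_insert_of_mem (Finset.mem_filter.mpr ⟨hb, hb0, hbT.le⟩))
      tauto
    · have := not_lt.mp hbT
      tauto
  · tauto

open scoped Classical in
/-- Some enabled action with the property `p`, if there is one. -/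
def pickEnabled (M : CTMDP L A) (l : L) (p : A → Prop) : A :=
  if h : ∃ a, M.Enabled l a ∧ p a then h.choose else M.someEnabled l

theorem enabled_pickEnabled (M : CTMDP L A) (l : L) (p : A → Prop) :
    M.Enabled l (M.pickEnabled l p) := by
  unfold pickEnabled
  split_ifs with h
  · exact h.choose_spec.1
  · exact (M.exists_enabled l).choose_spec

theorem pickEnabled_spec {l : L} {p : A → Prop} (h : ∃ a, M.Enabled l a ∧ p a) :
    p (M.pickEnabled l p) := by
  rw [pickEnabled, dif_pos h]
  exact h.choose_spec.2

/-- The timed positional scheduler that chooses, at time `t` in location `l`, an action `a` with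
`t ∈ C l a`, if there is one. Times are clamped to `[0,T]`. -/
def setScheduler (M : CTMDP L A) (hT : 0 ≤ T) (C : L → A → Set ℝ) : M.TPDScheduler where
  choice l t := M.pickEnabled l fun a => (Set.projIcc 0 T hT t : ℝ) ∈ C l a
  enabled l _ := M.enabled_pickEnabled l _

theorem setScheduler_congr (hT : 0 ≤ T) (C : L → A → Set ℝ) (l : L) {t t' : ℝ}
    (h : ∀ a, (Set.projIcc 0 T hT t : ℝ) ∈ C l a ↔ (Set.projIcc 0 T hT t' : ℝ) ∈ C l a) :
    (M.setScheduler hT C).choice l t = (M.setScheduler hT C).choice l t' :=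
  congrArg (M.pickEnabled l) (funext fun a => propext (h a))

theorem setScheduler_mem (hT : 0 ≤ T) {C : L → A → Set ℝ} {l : L} {t : ℝ} (ht : t ∈ Icc 0 T)
    (h : ∃ a, M.Enabled l a ∧ t ∈ C l a) : t ∈ C l ((M.setScheduler hT C).choice l t) := by
  have hp : (Set.projIcc 0 T hT t : ℝ) = t := by rw [projIcc_of_mem hT ht]
  have hs : (Set.projIcc 0 T hT t : ℝ) ∈ C l ((M.setScheduler hT C).choice l t) :=
    pickEnabled_spec (p := fun a => (Set.projIcc 0 T hT t : ℝ) ∈ C l a)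
      (by simpa only [hp] using h)
  rwa [hp] at hs

theorem isBorel_setScheduler (hT : 0 ≤ T) {C : L → A → Set ℝ}
    (hC : ∀ l a, MeasurableSet (C l a)) : (M.setScheduler hT C).IsBorel := by
  classical
  intro l a
  -- the choice is a function of the finite family of truth values of `t ∈ C l b`
  let G : ℝ → A → Prop := fun t b => (Set.projIcc 0 T hT t : ℝ) ∈ C l b
  have hG : Measurable G := measurable_pi_lambda _ fun b => measurableSet_setOfPred.mp
    ((measurable_subtype_coe.comp continuous_projIcc.measurable) (hC l b))
  have : {t | (M.setScheduler hT C).choice l t = a} =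
      G ⁻¹' (G '' {t | (M.setScheduler hT C).choice l t = a}) := by
    refine (subset_preimage_image _ _).antisymm ?_
    rintro t ⟨t', ht', heq⟩
    rw [mem_ofPred_eq, ← ht'.out]
    exact setScheduler_congr hT C l fun b => iff_of_eq (congrFun heq b).symm
  rw [this]
  exact hG (Set.toFinite _).measurableSet

theorem isCylindrical_setScheduler (hT : 0 ≤ T) {C : L → A → Set ℝ}
    (hC : ∀ l a, C l a ∈ cellAlgebra) : (M.setScheduler hT C).toTHR.IsCylindrical T := by
  classical
  choose hm J hJ using hC
  let K : Finset ℝ := Finset.univ.biUnion fun l => Finset.univ.biUnion fun a => J l a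
  refine ⟨insert T (K.filter fun b => 0 ≤ b ∧ b ≤ T), ⟨Finset.mem_insert_self _ _, ?_⟩, ?_⟩
  · intro b hb
    rcases Finset.mem_insert.mp hb with rfl | hb
    · exact ⟨hT, le_rfl⟩
    · exact (Finset.mem_filter.mp hb).2
  · intro s τ τ' t t' _ h
    have h' := h.projIcc hT
    funext a
    have hc : (M.setScheduler hT C).choice (s.loc (Fin.last _)) t =
        (M.setScheduler hT C).choice (s.loc (Fin.last _)) t' :=
      setScheduler_congr hT C _ fun a => hJ _ a _ _ fun b hb => h' b
        (Finset.mem_biUnion.mpr ⟨_, Finset.mem_univ _,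
          Finset.mem_biUnion.mpr ⟨a, Finset.mem_univ _, hb⟩⟩)
    change (if a = (M.setScheduler hT C).choice (s.loc (Fin.last _)) t then (1 : ℝ≥0) else 0) =
      if a = (M.setScheduler hT C).choice (s.loc (Fin.last _)) t' then 1 else 0
    rw [hc]

open scoped symmDiff in
/-- A Borel timed positional scheduler is the limit in measure of cylindrical ones. -/
theorem exists_cylindrical_approx (hT : 0 ≤ T) {S : M.TPDScheduler} (hS : S.IsBorel) {ε : ℝ}
    (hε : 0 < ε) : ∃ D : M.TPDScheduler, D.IsBorel ∧ D.toTHR.IsCylindrical T ∧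
      (volume.restrict (Icc 0 T)).real (disagree S D) ≤ ε := by
  set μ : Measure ℝ := volume.restrict (Icc 0 T) with hμ
  have : IsFiniteMeasure μ := ⟨by simp [hμ]⟩
  have hdense : μ.MeasureDense cellAlgebra :=
    Measure.MeasureDense.of_generateFrom_isSetAlgebra_finite _ isSetAlgebra_cellAlgebra
      generateFrom_cellAlgebra
  have hc : 0 < ((Fintype.card L : ℝ) * Fintype.card A + 1) := by positivity
  have happ : ∀ l a, ∃ C ∈ cellAlgebra, μ ({t | S.choice l t = a} ∆ C) <
      ENNReal.ofReal (ε / ((Fintype.card L : ℝ) * Fintype.card A + 1)) := fun l a =>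
    hdense.approx _ (hS l a) (measure_ne_top _ _) _ (by positivity)
  choose C hC hμC using happ
  refine ⟨M.setScheduler hT C, isBorel_setScheduler hT fun l a => (hC l a).1,
    isCylindrical_setScheduler hT hC, ?_⟩
  have hsub : disagree S (M.setScheduler hT C) ∩ Icc 0 T ⊆
      ⋃ l, ⋃ a, {t | S.choice l t = a} ∆ C l a := by
    rintro t ⟨⟨l, hl⟩, ht⟩
    by_contra hcon
    simp only [mem_iUnion, not_exists, mem_symmDiff, mem_ofPred_eq, not_or, not_and, not_not]
      at hcon
    have hiff : ∀ a, t ∈ C l a ↔ S.choice l t = a := fun a =>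
      ⟨(hcon l a).2, (hcon l a).1⟩
    exact hl ((hiff _).mp (setScheduler_mem hT ht ⟨_, S.enabled l t, (hiff _).mpr rfl⟩))
  have hle : μ (disagree S (M.setScheduler hT C)) ≤ ENNReal.ofReal ε := by
    calc μ (disagree S (M.setScheduler hT C))
        = μ (disagree S (M.setScheduler hT C) ∩ Icc 0 T) := by
          rw [hμ, Measure.restrict_apply' measurableSet_Icc,
            Measure.restrict_apply' measurableSet_Icc, inter_assoc, inter_self]
      _ ≤ ∑ l, ∑ a, μ ({t | S.choice l t = a} ∆ C l a) := by
          refine (measure_mono hsub).trans ((measure_iUnion_fintype_le _ _).trans ?_)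
          exact Finset.sum_le_sum fun l _ => measure_iUnion_fintype_le _ _
      _ ≤ ∑ _ : L, ∑ _ : A,
            ENNReal.ofReal (ε / ((Fintype.card L : ℝ) * Fintype.card A + 1)) :=
          Finset.sum_le_sum fun l _ => Finset.sum_le_sum fun a _ => (hμC l a).le
      _ = ENNReal.ofReal (∑ _ : L, ∑ _ : A,
            ε / ((Fintype.card L : ℝ) * Fintype.card A + 1)) := by
          rw [ENNReal.ofReal_sum_of_nonneg fun _ _ => by positivity]
          refine Finset.sum_congr rfl fun _ _ => ?_
          rw [ENNReal.ofReal_sum_of_nonneg fun _ _ => by positivity]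
      _ ≤ ENNReal.ofReal ε := by
          refine ENNReal.ofReal_le_ofReal ?_
          simp only [Finset.sum_const, Finset.card_univ, nsmul_eq_mul]
          rw [← mul_assoc, mul_div_assoc', div_le_iff₀ hc]
          nlinarith
  exact ENNReal.toReal_le_of_le_ofReal hε.le hle

theorem disagree_comm (D E : M.TPDScheduler) : disagree D E = disagree E D := by
  simp only [disagree, ne_comm]

theorem TPDScheduler.IsBorel.isMeasurable (hT : 0 ≤ T) {S : M.TPDScheduler} (hS : S.IsBorel) :
    S.toTHR.IsMeasurable T := by
  set μ : Measure ℝ := volume.restrict (Icc 0 T) with hμ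
  have : IsFiniteMeasure μ := ⟨by simp [hμ]⟩
  choose c hcB hcC hcd using fun n : ℕ =>
    exists_cylindrical_approx hT hS (Nat.one_div_pos_of_nat (α := ℝ) (n := n))
  have hC := M.rateBound_nonneg
  have hlim : Tendsto (fun n : ℕ => 2 * M.rateBound * (1 / ((n : ℝ) + 1))) atTop (𝓝 0) := by
    simpa using (tendsto_one_div_add_atTop_nhds_zero_nat (𝕜 := ℝ)).const_mul (2 * M.rateBound)
  refine ⟨hS.toTHR, fun n => (c n).toTHR, hcC, fun ε hε => ?_, ?_⟩
  · obtain ⟨N, hN⟩ := (hlim.eventually (gt_mem_nhds (half_pos hε))).exists_forall_of_atTop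
    refine ⟨N, fun m hm n hn => ?_⟩
    have hsub : disagree (c m) (c n) ⊆ disagree S (c m) ∪ disagree S (c n) := by
      rintro t ⟨l, hl⟩
      by_contra h
      simp only [mem_union, not_or, disagree, mem_ofPred_eq, not_exists, not_not] at h
      exact hl ((h.1 l).symm.trans (h.2 l))
    have h1 : μ.real (disagree (c m) (c n)) ≤ 1 / ((m : ℝ) + 1) + 1 / ((n : ℝ) + 1) :=
      (measureReal_mono hsub).trans ((measureReal_union_le _ _).trans
        (add_le_add (hcd m) (hcd n)))
    have h2 := mul_le_mul_of_nonneg_left h1 (by positivity : 0 ≤ 2 * M.rateBound)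
    have h3 := schedDist_le hT (hcB m) (hcB n)
    have h4 := hN m hm
    have h5 := hN n hn
    rw [mul_add] at h2
    linarith
  · refine squeeze_zero (fun n => schedDist_nonneg _ _) (fun n => ?_) hlim
    refine (schedDist_le hT (hcB n) hS).trans
      (mul_le_mul_of_nonneg_left ?_ (by positivity))
    rw [disagree_comm]
    exact hcd n

end CTMDP

end

/-! ### Selection of maximising actions -/

/-- A finite closed cover is also covered by the closures of the interiors of its members. -/
theorem iUnion_closure_interior_eq_univ {X ι : Type*} [TopologicalSpace X] [BaireSpace X]
    [Finite ι] {F : ι → Set X} (hc : ∀ i, IsClosed (F i)) (hU : ⋃ i, F i = univ) :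
    ⋃ i, closure (interior (F i)) = univ := by
  rw [← closure_iUnion_of_finite]
  exact (dense_iUnion_interior_of_closed hc hU).closure_eq

noncomputable section

namespace CTMDP

variable {L A : Type*} [Fintype L] [Fintype A] (M : CTMDP L A) {T : ℝ}

theorem continuous_gain {f : L → ℝ → ℝ} (hf : ∀ l, Continuous (f l)) (l : L) (a : A) :
    Continuous (M.gain f l a) := by
  unfold gain
  fun_prop

theorem continuous_bellman {f : L → ℝ → ℝ} (hf : ∀ l, Continuous (f l)) (l : L) :
    Continuous fun t => M.bellman (fun l => f l t) l :=
  (continuous_apply l).comp (M.lipschitzWith_bellman.continuous.comp (continuous_pi hf))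

/-- The points in time in `[0,T]` at which an action is optimal. -/
def optimalTimes (T : ℝ) (f : L → ℝ → ℝ) (l : L) (a : A) : Set (Icc 0 T) :=
  {t | M.Enabled l a ∧ M.gain f l a t = M.bellman (fun l => f l t) l}

theorem isClosed_optimalTimes {f : L → ℝ → ℝ} (hf : ∀ l, Continuous (f l)) (l : L) (a : A) :
    IsClosed (M.optimalTimes T f l a) :=
  isClosed_const.inter (isClosed_eq ((M.continuous_gain hf l a).comp continuous_subtype_val)
    ((M.continuous_bellman hf l).comp continuous_subtype_val))

theorem iUnion_optimalTimes (f : L → ℝ → ℝ) (l : L) : ⋃ a, M.optimalTimes T f l a = univ := by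
  refine eq_univ_of_forall fun t => ?_
  obtain ⟨a, ha, h⟩ := M.exists_eq_bellman (fun l => f l t) l
  exact mem_iUnion.mpr ⟨a, ha, h⟩

/-- The points in time in `[0,T]` at which `a` is the first action, for a fixed enumeration of the
actions, that is optimal on an open set with `t` in its closure. -/
def selectionTimes (T : ℝ) (f : L → ℝ → ℝ) (l : L) (a : A) : Set (Icc 0 T) :=
  closure (interior (M.optimalTimes T f l a)) \
    ⋃ b : {b : A // Fintype.equivFin A b < Fintype.equivFin A a},
      closure (interior (M.optimalTimes T f l b))

theorem exists_mem_selectionTimes {f : L → ℝ → ℝ} (hf : ∀ l, Continuous (f l)) (l : L)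
    (t : Icc 0 T) : ∃ a, t ∈ M.selectionTimes T f l a := by
  have h := iUnion_closure_interior_eq_univ (fun a => M.isClosed_optimalTimes (T := T) hf l a)
    (M.iUnion_optimalTimes f l)
  obtain ⟨a, ha⟩ := mem_iUnion.mp (h.symm ▸ mem_univ t)
  obtain ⟨a, ha, hmin⟩ := exists_minimal_of_wellFoundedLT
    (fun i => t ∈ closure (interior (M.optimalTimes T f l ((Fintype.equivFin A).symm i))))
    ⟨Fintype.equivFin A a, by simpa using ha⟩
  refine ⟨(Fintype.equivFin A).symm a, ha, fun hb => ?_⟩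
  obtain ⟨⟨b, hlt⟩, hb⟩ := mem_iUnion.mp hb
  rw [Equiv.apply_symm_apply] at hlt
  exact absurd (hmin (by simpa using hb) hlt.le) (not_le.mpr hlt)

theorem eq_of_mem_selectionTimes {f : L → ℝ → ℝ} {l : L} {t : Icc 0 T} {a b : A}
    (ha : t ∈ M.selectionTimes T f l a) (hb : t ∈ M.selectionTimes T f l b) : a = b := by
  by_contra hne
  rcases lt_or_gt_of_ne ((Fintype.equivFin A).injective.ne hne) with h | h
  · exact hb.2 (mem_iUnion.mpr ⟨⟨a, h⟩, ha.1⟩)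
  · exact ha.2 (mem_iUnion.mpr ⟨⟨b, h⟩, hb.1⟩)

theorem selectionTimes_subset {f : L → ℝ → ℝ} (hf : ∀ l, Continuous (f l)) (l : L) (a : A) :
    M.selectionTimes T f l a ⊆ M.optimalTimes T f l a :=
  sdiff_subset.trans (closure_minimal interior_subset (M.isClosed_optimalTimes hf l a))

theorem isOpen_compl_iUnion_closure_interior (f : L → ℝ → ℝ) (l : L) (a : A) :
    IsOpen (⋃ b : {b : A // Fintype.equivFin A b < Fintype.equivFin A a},
      closure (interior (M.optimalTimes T f l b)))ᶜ :=
  (isClosed_iUnion_of_finite fun _ => isClosed_closure).isOpen_compl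

theorem measurableSet_selectionTimes (f : L → ℝ → ℝ) (l : L) (a : A) :
    MeasurableSet (M.selectionTimes T f l a) :=
  isClosed_closure.measurableSet.inter
    (M.isOpen_compl_iUnion_closure_interior f l a).measurableSet

theorem image_selectionTimes (f : L → ℝ → ℝ) (l : L) (a : A) :
    ∃ O U : Set ℝ, IsOpen O ∧ IsOpen U ∧ U ⊆ O ∧
      Subtype.val '' M.selectionTimes T f l a = closure (U ∩ Icc 0 T) ∩ (O ∩ Icc 0 T) := by
  obtain ⟨O, hO, hO'⟩ := isOpen_induced_iff.mp
    (M.isOpen_compl_iUnion_closure_interior (T := T) f l a)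
  obtain ⟨V, hV, hV'⟩ := isOpen_induced_iff.mp
    (isOpen_interior (s := M.optimalTimes T f l a))
  refine ⟨O, V ∩ O, hO, hV.inter hO, inter_subset_right, ?_⟩
  rw [selectionTimes, sdiff_eq, ← hO', ← hV']
  ext x
  constructor
  · rintro ⟨⟨x, hx⟩, ⟨h1, h2⟩, rfl⟩
    rw [closure_subtype, Subtype.image_preimage_val] at h1
    refine ⟨?_, h2, hx⟩
    have : x ∈ O ∩ closure (Icc 0 T ∩ V) := ⟨h2, h1⟩
    refine closure_mono ?_ (hO.inter_closure this)
    rintro y ⟨hy1, hy2, hy3⟩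
    exact ⟨⟨hy3, hy1⟩, hy2⟩
  · rintro ⟨h1, h2, hx⟩
    refine ⟨⟨x, hx⟩, ⟨?_, h2⟩, rfl⟩
    rw [closure_subtype, Subtype.image_preimage_val]
    have hsub : V ∩ O ∩ Icc 0 T ⊆ Icc 0 T ∩ V := fun y hy => ⟨hy.2, hy.1.1⟩
    exact closure_mono hsub h1

/-- The timed positional scheduler that follows `selectionTimes`. -/
def optimalScheduler (hT : 0 ≤ T) (f : L → ℝ → ℝ) : M.TPDScheduler :=
  M.setScheduler hT fun l a => Subtype.val '' M.selectionTimes T f l a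

theorem isBorel_optimalScheduler (hT : 0 ≤ T) (f : L → ℝ → ℝ) :
    (M.optimalScheduler hT f).IsBorel :=
  isBorel_setScheduler hT fun l a =>
    measurableSet_Icc.subtype_image (M.measurableSet_selectionTimes f l a)

theorem mem_selectionTimes_optimalScheduler (hT : 0 ≤ T) {f : L → ℝ → ℝ}
    (hf : ∀ l, Continuous (f l)) (l : L) (t : Icc 0 T) :
    t ∈ M.selectionTimes T f l ((M.optimalScheduler hT f).choice l t) := by
  obtain ⟨a, ha⟩ := M.exists_mem_selectionTimes hf l t
  obtain ⟨t', ht', heq⟩ := setScheduler_mem (M := M) hT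
    (C := fun l a => Subtype.val '' M.selectionTimes T f l a) (l := l) t.2
    ⟨a, (M.selectionTimes_subset hf l a ha).1, t, ha, rfl⟩
  rwa [Subtype.ext heq] at ht'

theorem setOf_optimalScheduler_eq (hT : 0 ≤ T) {f : L → ℝ → ℝ}
    (hf : ∀ l, Continuous (f l)) (l : L) (a : A) :
    {t ∈ Icc 0 T | (M.optimalScheduler hT f).choice l t = a} =
      Subtype.val '' M.selectionTimes T f l a := by
  ext t
  constructor
  · rintro ⟨ht, rfl⟩
    exact ⟨⟨t, ht⟩, M.mem_selectionTimes_optimalScheduler hT hf l ⟨t, ht⟩, rfl⟩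
  · rintro ⟨t, ht, rfl⟩
    exact ⟨t.2, M.eq_of_mem_selectionTimes (M.mem_selectionTimes_optimalScheduler hT hf l t) ht⟩

theorem gain_optimalScheduler (hT : 0 ≤ T) {f : L → ℝ → ℝ} (hf : ∀ l, Continuous (f l)) (l : L)
    {t : ℝ} (ht : t ∈ Icc 0 T) :
    M.gain f l ((M.optimalScheduler hT f).choice l t) t = M.bellman (fun l => f l t) l :=
  (M.selectionTimes_subset hf l _
    (M.mem_selectionTimes_optimalScheduler hT hf l ⟨t, ht⟩)).2

/-! ### Verification -/

variable {M}

theorem IsBellmanMax.isValueFunction {f : L → ℝ → ℝ} (hf : M.IsBellmanMax T f)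
    (hc : ∀ l, Continuous (f l)) (h01 : ∀ l t, f l t ∈ Icc (0 : ℝ) 1) :
    IsValueFunction T f fun l t => M.bellman (fun l => f l t) l where
  measurable l := (hc l).measurable
  nonneg l u _ := (h01 l u).1
  bounded := ⟨1, fun l u _ => (h01 l u).2⟩
  integrable l := (M.continuous_bellman hc l).intervalIntegrable _ _
  eq_integral l u hu := by
    have h := intervalIntegral.integral_eq_sub_of_hasDerivAt_of_le hu.2 (hc l).continuousOn
      (f' := fun t => -M.bellman (fun l => f l t) l)
      (fun t ht => (hf.deriv l t ⟨hu.1.trans ht.1.le, ht.2.le⟩).hasDerivAt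
        (Icc_mem_nhds (hu.1.trans_lt ht.1) ht.2))
      ((M.continuous_bellman hc l).neg.intervalIntegrable _ _)
    rw [intervalIntegral.integral_neg] at h
    linarith

theorem drift_le_bellman (σ : M.THRScheduler) (f : L → ℝ → ℝ) (π : TimedPath L A) (u : ℝ) :
    M.drift σ f π u ≤ M.bellman (fun l => f l u) π.last := by
  calc M.drift σ f π u
      ≤ ∑ a, (σ.prob π u a : ℝ) * M.bellman (fun l => f l u) π.last := by
        refine Finset.sum_le_sum fun a _ => ?_
        by_cases ha : σ.prob π u a = 0
        · simp [ha]
        · exact mul_le_mul_of_nonneg_left (M.le_bellman _ (σ.enabled π u a ha))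
            (NNReal.coe_nonneg _)
    _ = _ := by rw [← Finset.sum_mul, M.sum_coe_prob, one_mul]

theorem drift_toTHR (S : M.TPDScheduler) (f : L → ℝ → ℝ) (π : TimedPath L A) (u : ℝ) :
    M.drift S.toTHR f π u = M.gain f π.last (S.choice π.last u) u := by
  classical
  rw [drift, Finset.sum_eq_single (S.choice π.last u)]
  · simp [TPDScheduler.toTHR]
  · intro a _ ha
    simp [TPDScheduler.toTHR, ha]
  · simp

theorem IsBellmanMax.congr {f g : L → ℝ → ℝ} (hf : M.IsBellmanMax T f) (hT : 0 ≤ T)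
    (h : ∀ l, ∀ t ∈ Icc 0 T, g l t = f l t) : M.IsBellmanMax T g where
  goal l hl t ht := (h l t ht).trans (hf.goal l hl t ht)
  final l hl := (h l T ⟨hT, le_rfl⟩).trans (hf.final l hl)
  deriv l t ht := by
    have hg : ∀ a, M.gain g l a t = M.gain f l a t := fun a => by simp [gain, h _ t ht]
    simp only [hg]
    exact (hf.deriv l t ht).congr (fun u hu => h l u hu) (h l t ht)

end CTMDP

end

theorem theorem1 {L A : Type*} [Fintype L] [Fintype A] (M : CTMDP L A) (T : ℝ) (hT : 0 ≤ T) :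
    ∃ S : M.TPDScheduler,
      -- `S` is a measurable scheduler
      S.toTHR.IsMeasurable T ∧
      -- `S` is optimal among all measurable THR schedulers
      (∀ σ : M.THRScheduler, σ.IsMeasurable T →
        M.reachProb T σ ≤ M.reachProb T S.toTHR ∧
        ∀ l, ∀ t ∈ Set.Icc 0 T, M.reach T σ l t ≤ M.reach T S.toTHR l t) ∧
      -- its reachability function is the unique solution of the Bellman equations
      M.IsBellmanMax T (M.reach T S.toTHR) ∧
      (∀ f, M.IsBellmanMax T f → ∀ l, ∀ t ∈ Set.Icc 0 T, M.reach T S.toTHR l t = f l t) ∧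
      -- `S` chooses only gain-maximising actions
      (∀ l, ∀ t ∈ Set.Icc 0 T, ∀ a, M.Enabled l a →
        M.gain (M.reach T S.toTHR) l a t ≤ M.gain (M.reach T S.toTHR) l (S.choice l t) t) ∧
      -- each decision is taken on the closure of an open set relative to an open set in `[0,T]`
      (∀ l a, ∃ O U : Set ℝ, IsOpen O ∧ IsOpen U ∧ U ⊆ O ∧
        {t ∈ Set.Icc 0 T | S.choice l t = a} =
          closure (U ∩ Set.Icc 0 T) ∩ (O ∩ Set.Icc 0 T)) := by
  obtain ⟨f, hf, hc, h01⟩ := M.exists_isBellmanMax hT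
  have hV := hf.isValueFunction hc h01
  have hTT : T ∈ Icc 0 T := ⟨hT, le_rfl⟩
  have hSB := M.isBorel_optimalScheduler hT f
  have hreach : ∀ l, ∀ t ∈ Icc 0 T,
      M.reach T (M.optimalScheduler hT f).toTHR l t = f l t := fun l t ht =>
    M.reach_eq hSB.toTHR hV
      (fun π u hu => by rw [CTMDP.drift_toTHR, M.gain_optimalScheduler hT hc _ hu])
      (fun l hl => hf.goal l hl T hTT) (fun l hl => hf.final l hl) l ht
  have hle : ∀ σ : M.THRScheduler, σ.IsMeasurable T → ∀ l, ∀ t ∈ Icc 0 T,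
      M.reach T σ l t ≤ M.reach T (M.optimalScheduler hT f).toTHR l t := fun σ hσ l t ht => by
    rw [hreach l t ht]
    exact M.reach_le hσ.borel hV (fun π u _ => CTMDP.drift_le_bellman σ f π u)
      (fun l hl => (hf.goal l hl T hTT).ge) l ht
  -- gains at time `t` depend on the values at time `t` only
  have hgain : ∀ l a, ∀ t ∈ Icc 0 T,
      M.gain (M.reach T (M.optimalScheduler hT f).toTHR) l a t = M.gain f l a t :=
    fun l a t ht => by simp [CTMDP.gain, hreach _ t ht]
  have hB := hf.congr hT hreach
  refine ⟨M.optimalScheduler hT f, hSB.isMeasurable hT, fun σ hσ => ⟨?_, hle σ hσ⟩, hB,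
    fun g hg l t ht => hB.eqOn M hg l ht, fun l t ht a ha => ?_, fun l a => ?_⟩
  · exact Finset.sum_le_sum fun l _ =>
      mul_le_mul_of_nonneg_left (hle σ hσ l 0 ⟨le_rfl, hT⟩) (NNReal.coe_nonneg _)
  · rw [hgain l _ t ht, hgain l _ t ht, M.gain_optimalScheduler hT hc l ht]
    exact M.le_bellman _ ha
  · rw [M.setOf_optimalScheduler_eq hT hc]
    exact M.image_selectionTimes f l a
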